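/- Let $\mathcal H'$ be a real Hilbert space with a symmetry $J=J^*=J^{-1}$. A \emph{chiral complex structure} is a bounded operator $I$ on $\mathcal H'$ that is skew-adjoint and orthogonal ($I^*=-I$, $I^*I=II^*=\mathbf 1$) and satisfies $JIJ=-I$. A pair $(I_0,I_1)$ of chiral complex structures is a \emph{Fredholm pair} if the norm of the class of $I_0-I_1$ in the Calkin algebra (bounded operators modulo compact operators) is less than $2$; its $\mathbb Z_2$-index is $$\mathrm{PI}(I_0,I_1)=\tfrac12\dim_{\mathbb R}\ker(I_0+I_1)\ \bmod 2 .$$ The $\mathbb Z_2$-valued spectral flow is defined as follows. For invertible skew-adjoint $S_0,S_1$ on a finite-dimensional real inner product space, $\mathrm{SF}_2(S_0,S_1)=\operatorname{sgn}\det A\in\{1,-1\}$ for any invertible $A$ with $S_1=A^*S_0A$. Let $[0,1]\ni t\mapsto T_t$ be a norm-continuous path of bounded skew-adjoint Fredholm operators on $\mathcal H'$ with $T_0,T_1$ invertible, and for $a>0$ let $Q_a(t)=\chi_{(-a,a)}(\imath T_t)$. Choose a partition $0=t_0<\dots<t_N=1$ and $a_n>0$ ($1\le n\le N$) such that, for $t\in[t_{n-1},t_n]$,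 $Q_{a_n}(t)$ has finite rank, depends norm-continuously on $t$ and satisfies $\|Q_{a_n}(t)-Q_{a_n}(t')\|<1$ for all $t,t'\in[t_{n-1},t_n]$. For each $n=0,\dots,N$ choose a skew-adjoint operator $R_n$ that is invertible on $\ker T_{t_n}$ and vanishes on its orthogonal complement. Let $V_n:\operatorname{Ran}Q_{a_n}(t_{n-1})\to\operatorname{Ran}Q_{a_n}(t_n)$, $V_nv=Q_{a_n}(t_n)v$, and put $$\mathrm{SF}_2\big([0,1]\ni t\mapsto T_t\big)=\prod_{n=1}^N\mathrm{SF}_2\Big(Q_{a_n}(t_{n-1})T_{t_{n-1}}Q_{a_n}(t_{n-1})+R_{n-1},\ V_n^*\big(Q_{a_n}(t_n)T_{t_n}Q_{a_n}(t_n)+R_n\big)V_n\Big),$$ where the factors are taken on the finite-dimensional space $\operatorname{Ran}Q_{a_n}(t_{n-1})$. The spectral flow of a path is well-defined if such choices exist and all of them give the same value. \textbf{Proposition.} For any Fredholm pair $(I_0,I_1)$ of chiral complex structures on $\mathcal H'$, the operators $(1-t)I_0+tI_1$, $t\in[0,1]$, are skew-adjoint, Fredholm and anticommute with $J$; the kernel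 of $I_0+I_1$ has finite even dimension; the $\mathbb Z_2$-valued spectral flow of the straight-line path is well-defined; and $$\mathrm{SF}_2\big([0,1]\ni t\mapsto(1-t)I_0+tI_1\big)=(-1)^{\mathrm{PI}(I_0,I_1)} .$$ -/

import Mathlib

noncomputable section

namespace ChiralFlow

universe u

/-! ### Chiral complex structures, Fredholm pairs and their index -/

section Operators

variable {H : Type u} [NormedAddCommGroup H] [InnerProductSpace ℝ H] [CompleteSpace H]

/-- A symmetry `J = J* = J⁻¹` of a real Hilbert space (the grading). -/
structure IsSymmetry (J : H →L[ℝ] H) : Prop where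
  selfAdjoint : IsSelfAdjoint J
  sq_eq_one : J * J = 1

/-- A complex structure: a skew-adjoint unitary (that is, orthogonal) operator. -/
structure IsComplexStructure (I : H →L[ℝ] H) : Prop where
  skew : star I = -I
  isUnitary : I ∈ unitary (H →L[ℝ] H)

/-- A complex structure that is chiral with respect to the symmetry `J`. -/
structure IsChiralComplexStructure (J I : H →L[ℝ] H) : Prop extends IsComplexStructure I where
  chiral : J * I * J = -I

/-- The norm of the class of `A` in the Calkin algebra: the quotient norm modulo the compact
operators. -/
def calkinNorm (A : H →L[ℝ] H) : ℝ :=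
  ‖(Submodule.Quotient.mk A : (H →L[ℝ] H) ⧸ compactOperator (RingHom.id ℝ) H H)‖

/-- A Fredholm pair of chiral complex structures. -/
structure IsFredholmPair (J I₀ I₁ : H →L[ℝ] H) : Prop where
  left : IsChiralComplexStructure J I₀
  right : IsChiralComplexStructure J I₁
  calkinNorm_lt : calkinNorm (I₀ - I₁) < 2

/-- The `ℤ₂`-index of a pair of complex structures: half the dimension of the kernel of
`I₀ + I₁`, modulo 2. -/
def z2Index (I₀ I₁ : H →L[ℝ] H) : ZMod 2 :=
  ((Module.finrank ℝ (LinearMap.ker (I₀ + I₁ : H →L[ℝ] H).toLinearMap) / 2 : ℕ) : ZMod 2)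

/-- The identification of the additive group `ℤ/2` with the multiplicative group `{1, -1}`. -/
def z2Sign (z : ZMod 2) : ℤ := (-1) ^ z.val

/-- The skew-adjoint Fredholm operators. -/
def skewFredholm (H : Type u) [NormedAddCommGroup H] [InnerProductSpace ℝ H] [CompleteSpace H] :
    Set (H →L[ℝ] H) :=
  {T | star T = -T ∧ T.IsFredholm}

/-- The skew-adjoint Fredholm operators that are chiral with respect to `J`. -/
def chiralSkewFredholm (J : H →L[ℝ] H) : Set (H →L[ℝ] H) :=
  {T | T ∈ skewFredholm H ∧ J * T * J = -T}

/-- The straight line from `I₀` to `I₁`. -/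
def linePath (I₀ I₁ : H →L[ℝ] H) (t : ℝ) : H →L[ℝ] H := (1 - t) • I₀ + t • I₁

/-- An admissible path: a norm-continuous path `[0,1] ∋ t ↦ T t` of skew-adjoint Fredholm operators
with invertible endpoints. -/
structure IsAdmissiblePath (T : ℝ → H →L[ℝ] H) : Prop where
  continuousOn : ContinuousOn T (Set.Icc 0 1)
  mem : ∀ t ∈ Set.Icc (0 : ℝ) 1, T t ∈ skewFredholm H
  isUnit_zero : IsUnit (T 0)
  isUnit_one : IsUnit (T 1)

/-- For skew-adjoint `T` and `a > 0`, the orthogonal projection `Q` is the spectral projection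
`χ_{(-a,a)}(i T)`. Since `|i T| = |T|` and `‖|T| x‖ = ‖T x‖`, this is the unique orthogonal
projection that reduces `T`, such that `‖T x‖ < a ‖x‖` for the nonzero vectors `x` of its range and
`‖T x‖ ≥ a ‖x‖` for the vectors `x` of its kernel. -/
structure IsSpectralProjection (T : H →L[ℝ] H) (a : ℝ) (Q : H →L[ℝ] H) : Prop where
  isStarProjection : IsStarProjection Q
  commute : Commute Q T
  lt_on_range : ∀ x, Q x = x → x ≠ 0 → ‖T x‖ < a * ‖x‖
  le_on_ker : ∀ x, Q x = 0 → a * ‖x‖ ≤ ‖T x‖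

end Operators

/-! ### The `ℤ₂`-valued spectral flow in finite dimension -/

/-- The `ℤ₂`-valued spectral flow between invertible skew-adjoint operators `T₀`, `T₁` on a
finite-dimensional space: the sign of `det A` for an invertible `A` with `T₁ = A* T₀ A`
(with the value `0` if there is no such `A`). -/
def finiteFlow {E : Type*} [NormedAddCommGroup E] [InnerProductSpace ℝ E] [FiniteDimensional ℝ E]
    (T₀ T₁ : E →ₗ[ℝ] E) : ℤ :=
  open Classical in
  if h : ∃ A : E ≃ₗ[ℝ] E,
      T₁ = LinearMap.adjoint A.toLinearMap ∘ₗ T₀ ∘ₗ A.toLinearMap then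
    (SignType.sign (LinearMap.det h.choose.toLinearMap) : ℤ)
  else 0

/-! ### The `ℤ₂`-valued spectral flow of a path of skew-adjoint Fredholm operators -/

section Flow

variable {H : Type u} [NormedAddCommGroup H] [InnerProductSpace ℝ H] [CompleteSpace H]

/-- The range of a bounded operator. -/
abbrev ran (Q : H →L[ℝ] H) : Submodule ℝ H := LinearMap.range Q.toLinearMap

/-- The compression `Q A Q` of `A`, as an operator on the range of the projection `Q`. -/
def compression (Q A : H →L[ℝ] H) : ran Q →ₗ[ℝ] ran Q :=
  Q.toLinearMap.rangeRestrict ∘ₗ A.toLinearMap ∘ₗ (ran Q).subtype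

/-- The map `v ↦ Q' v` from the range of `Q` to the range of `Q'`. -/
def transfer (Q Q' : H →L[ℝ] H) : ran Q →ₗ[ℝ] ran Q' :=
  Q'.toLinearMap.rangeRestrict ∘ₗ (ran Q).subtype

/-- `SF₂(Q A Q, V* (Q' A' Q') V)` on the range of `Q`, where `V` is the transfer map from the range
of `Q` to the range of `Q'`. -/
def pieceFlow (Q Q' A A' : H →L[ℝ] H)
    [FiniteDimensional ℝ (ran Q)] [FiniteDimensional ℝ (ran Q')] : ℤ :=
  finiteFlow (compression Q A)
    (LinearMap.adjoint (transfer Q Q') ∘ₗ compression Q' A' ∘ₗ transfer Q Q')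

/-- The choices that enter the definition of the `ℤ₂`-valued spectral flow of `[0,1] ∋ t ↦ T t`:
a partition `0 = t₀ < ⋯ < t_N = 1`, numbers `aₙ > 0` for which the spectral projections
`Qₙ(t) = χ_{(-aₙ,aₙ)}(i T t)` have finite rank and depend continuously on `t ∈ [tₙ₋₁, tₙ]` with
oscillation less than `1` (so that the transfer maps are bijective), and, at each point `tₙ` of the
partition, a skew-adjoint invertible perturbation `Rₙ` on the kernel of `T tₙ`.
The piece `[tₙ₋₁, tₙ]` is indexed by `n - 1 : Fin N`. -/
structure FlowData (T : ℝ → H →L[ℝ] H) where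
  N : ℕ
  t : Fin (N + 1) → ℝ
  t_strictMono : StrictMono t
  t_zero : t 0 = 0
  t_last : t (Fin.last N) = 1
  a : Fin N → ℝ
  a_pos : ∀ n, 0 < a n
  Q : Fin N → ℝ → H →L[ℝ] H
  isSpectralProjection : ∀ n, ∀ s ∈ Set.Icc (t n.castSucc) (t n.succ),
    IsSpectralProjection (T s) (a n) (Q n s)
  finiteDimensional : ∀ n, ∀ s ∈ Set.Icc (t n.castSucc) (t n.succ),
    FiniteDimensional ℝ (ran (Q n s))
  continuousOn : ∀ n, ContinuousOn (Q n) (Set.Icc (t n.castSucc) (t n.succ))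
  norm_sub_lt : ∀ n, ∀ s ∈ Set.Icc (t n.castSucc) (t n.succ),
    ∀ s' ∈ Set.Icc (t n.castSucc) (t n.succ), ‖Q n s - Q n s'‖ < 1
  R : Fin (N + 1) → H →L[ℝ] H
  R_skew : ∀ n, star (R n) = -R n
  /-- The range of `Rₙ` lies in the kernel of `T tₙ`; by skew-adjointness `Rₙ` then also vanishes on
  the orthogonal complement of that kernel. -/
  R_range : ∀ n x, T (t n) (R n x) = 0
  /-- `Rₙ` is injective on the finite-dimensional kernel of `T tₙ`, so that the compression of
  `T tₙ + Rₙ` to the range of a spectral projection of finite rank is invertible. -/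
  R_injective : ∀ n x, T (t n) x = 0 → R n x = 0 → x = 0

/-- The product over the pieces of the partition that defines the `ℤ₂`-valued spectral flow. -/
def FlowData.value {T : ℝ → H →L[ℝ] H} (D : FlowData T) : ℤ :=
  ∏ n : Fin D.N,
    haveI hlt : D.t n.castSucc ≤ D.t n.succ := D.t_strictMono.monotone (Fin.castSucc_le_succ n)
    haveI := D.finiteDimensional n (D.t n.castSucc) (Set.left_mem_Icc.2 hlt)
    haveI := D.finiteDimensional n (D.t n.succ) (Set.right_mem_Icc.2 hlt)
    pieceFlow (D.Q n (D.t n.castSucc)) (D.Q n (D.t n.succ))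
      (T (D.t n.castSucc) + D.R n.castSucc) (T (D.t n.succ) + D.R n.succ)

/-- The `ℤ₂`-valued spectral flow of `T` is (well-defined and equal to) `σ`: the path `T` is
admissible, there are choices as in `FlowData`, and all of them give the value `σ`. -/
def HasZ2SpectralFlow (T : ℝ → H →L[ℝ] H) (σ : ℤ) : Prop :=
  IsAdmissiblePath T ∧ Nonempty (FlowData T) ∧ ∀ D : FlowData T, D.value = σ

/-- The `ℤ₂`-valued spectral flow, with values in the multiplicative group `{1, -1}`: the common
value of all the choices (with the value `0` if the spectral flow is not well-defined). -/
def z2SpectralFlow (T : ℝ → H →L[ℝ] H) : ℤ :=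
  open Classical in
  if h : ∃ σ, HasZ2SpectralFlow T σ then h.choose else 0

end Flow

end ChiralFlow

end

noncomputable section

set_option linter.unusedSectionVars false

namespace ChiralFlow

/-! ### Determinants and complex structures -/

/-! Write `G = I₀ + I₁` and `T_t` for the straight line. Since `I₀² = I₁² = -1`, one has `T_t² =
-(1-2t)² + t(1-t)G²`, and this identity does two jobs. It bounds `T_t` below except at `t = 1/2`,
where `T_t = G/2`; there the Calkin bound makes `-I₀G` a compact perturbation of an invertible
operator, so `ker G` is finite-dimensional and `G` is bounded below on its complement. It also ties
every spectral projection to the single operator `G²`: two of them at the same level `a`, one of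
finite rank, coincide as soon as their distance is less than `1`
(`IsSpectralProjection.eq_of_norm_sub_lt`). Hence on each piece of a partition the projection does
not move, it reduces both `I₀` and `I₁`, and the transfer map is the identity.

On such a fixed finite-dimensional space, skew operators are compared with a complex structure `I`
by writing `X = C* I C` and taking the sign of `det C`. The engine is `det_pos_of_inner_nonneg`:
`det C > 0` whenever `⟪X x, I x⟫ ≥ 0`. For `X = I` this shows that the sign does not depend on `C`;
for `X = T_t` it gives sign `1` relative to `I₀` before `1/2` and relative to `I₁` after it.

To cross `1/2`, compare `I₀` and `I₁` through the midpoint with its kernel filled by `I₀`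
(`hasRelSign_midpoint`, `hasRelSign_of_kerSymm`). Relative to `I₀` the sign is `1`. Relative to
`I₁`, which equals `-I₀` on `ker G`, the filling is the pullback by `J`, so the sign is that of `det
(J|ker G)`. As `I₀` exchanges the eigenspaces of `J` there, this determinant is `(-1)^(dim/2)`.

Finally each partition point carries a sign, a piece contributes the product of its two end signs,
and the product telescopes; the choice of `R` at `1/2` enters only through a square. -/

theorem det_nonneg_of_commute {E : Type*} [AddCommGroup E] [Module ℝ E]
    {I M : Module.End ℝ E} (hI : I * I = -1) (hM : Commute M I) : 0 ≤ LinearMap.det M := by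
  -- `I` turns `E` into a complex vector space on which `M` is complex linear; its real determinant
  -- is then the squared modulus of the complex one.
  let φ : ℂ →ₐ[ℝ] Module.End ℝ E := Complex.lift ⟨I, hI⟩
  have hφ : ∀ z x, φ z x = z.re • x + z.im • I x := fun z x => by
    simp [φ, Complex.liftAux_apply, Algebra.algebraMap_eq_smul_one]
  let : Module ℂ E := Module.compHom E φ.toRingHom
  have hs : ∀ (z : ℂ) (x : E), z • x = z.re • x + z.im • I x := hφ
  have : IsScalarTower ℝ ℂ E := ⟨fun r z x => by
    rw [hs, hs]; simp [mul_smul]⟩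
  let M' : E →ₗ[ℂ] E :=
    { toFun := M
      map_add' := map_add M
      map_smul' := fun z x => by
        have : M (I x) = I (M x) := LinearMap.congr_fun hM.eq x
        simp [hs, this] }
  have h : M = M'.restrictScalars ℝ := rfl
  rw [h, LinearMap.det_restrictScalars, Algebra.norm_complex_apply]
  exact Complex.normSq_nonneg _

section Inner

variable {E : Type*} [NormedAddCommGroup E] [InnerProductSpace ℝ E] [FiniteDimensional ℝ E]

open scoped InnerProductSpace

/-- The segment from the identity to `B` keeps a positive quadratic form, hence stays invertible,
and the determinant cannot change sign along it. No symmetry of `B` is needed. -/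
theorem det_pos_of_inner_pos {B : E →ₗ[ℝ] E} (hB : ∀ x, x ≠ 0 → 0 < ⟪B x, x⟫_ℝ) :
    0 < LinearMap.det B := by
  classical
  let b := Module.finBasis ℝ E
  let f : ℝ → ℝ := fun s => ((1 - s) • (1 : Matrix _ _ ℝ) + s • LinearMap.toMatrix b b B).det
  have hf : Continuous f := by
    unfold f
    fun_prop
  have hfd : ∀ s, f s = LinearMap.det ((1 - s) • (LinearMap.id : E →ₗ[ℝ] E) + s • B) := fun s => by
    rw [← LinearMap.det_toMatrix b]
    simp [f]
  have hne : ∀ s ∈ Set.Icc (0 : ℝ) 1, f s ≠ 0 := by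
    intro s hs h0
    rw [hfd] at h0
    have := LinearMap.bot_lt_ker_of_det_eq_zero h0
    obtain ⟨x, hx, hx0⟩ := (Submodule.ne_bot_iff _).1 this.ne'
    have h1 : ⟪(1 - s) • x + s • B x, x⟫_ℝ = 0 := by
      have : (1 - s) • x + s • B x = 0 := by simpa using hx
      rw [this, inner_zero_left]
    rw [inner_add_left, real_inner_smul_left, real_inner_smul_left] at h1
    have h2 := hB x hx0
    have h3 : 0 < ⟪x, x⟫_ℝ := real_inner_self_pos.2 hx0
    rcases hs.1.eq_or_lt with rfl | hs0
    · simp at h1; exact hx0 h1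
    · nlinarith [mul_pos hs0 h2, mul_nonneg (sub_nonneg.2 hs.2) h3.le]
  have h0 : f 0 = 1 := by simp [f]
  have h1 : f 1 = LinearMap.det B := by rw [hfd]; simp
  rw [← h1]
  by_contra hcon
  obtain ⟨s, hs, hs'⟩ := intermediate_value_Icc' zero_le_one hf.continuousOn
    (show (0 : ℝ) ∈ Set.Icc (f 1) (f 0) from ⟨not_lt.1 hcon, by rw [h0]; exact zero_le_one⟩)
  exact hne s hs hs'

/-- A skew-adjoint complex structure of a finite-dimensional space. -/
structure IsSkewUnit (I : E →ₗ[ℝ] E) : Prop where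
  adjoint_eq : LinearMap.adjoint I = -I
  apply_apply : ∀ x, I (I x) = -x

theorem IsSkewUnit.inner_left {I : E →ₗ[ℝ] E} (hI : IsSkewUnit I) (x y : E) :
    ⟪I x, y⟫_ℝ = -⟪x, I y⟫_ℝ := by
  rw [← LinearMap.adjoint_inner_right, hI.adjoint_eq]; simp

theorem IsSkewUnit.inner_map {I : E →ₗ[ℝ] E} (hI : IsSkewUnit I) (x y : E) :
    ⟪I x, I y⟫_ℝ = ⟪x, y⟫_ℝ := by
  rw [hI.inner_left, hI.apply_apply, inner_neg_right, neg_neg]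

theorem det_adjoint (A : E →ₗ[ℝ] E) : LinearMap.det (LinearMap.adjoint A) = LinearMap.det A := by
  let b := (stdOrthonormalBasis ℝ E).toBasis
  rw [← LinearMap.det_toMatrix b, ← LinearMap.det_toMatrix b, LinearMap.toMatrix_adjoint,
    Matrix.conjTranspose_eq_transpose_of_trivial, Matrix.det_transpose]

/-- `B = A - I A I` commutes with `I`, so `det B ≥ 0`; the hypothesis, applied at `I x`, makes the
quadratic form of `A* B` positive, so `det A * det B > 0`. -/
theorem det_pos_of_inner_nonneg {I : E →ₗ[ℝ] E} (hI : IsSkewUnit I) (A : E ≃ₗ[ℝ] E)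
    (h : ∀ x, 0 ≤ ⟪I (A x), A (I x)⟫_ℝ) : 0 < LinearMap.det A.toLinearMap := by
  let B : E →ₗ[ℝ] E := A.toLinearMap - I ∘ₗ A.toLinearMap ∘ₗ I
  have hB : 0 ≤ LinearMap.det B := by
    refine det_nonneg_of_commute (I := I) (LinearMap.ext fun x => by simp [hI.apply_apply]) ?_
    refine LinearMap.ext fun x => ?_
    simp [B, hI.apply_apply, add_comm]
  have hpos : 0 < LinearMap.det (LinearMap.adjoint A.toLinearMap ∘ₗ B) := by
    refine det_pos_of_inner_pos fun x hx => ?_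
    rw [LinearMap.comp_apply, LinearMap.adjoint_inner_left]
    have h1 : 0 < ⟪A x, A x⟫_ℝ := real_inner_self_pos.2 (by simpa using hx)
    have h2 := h (I x)
    simp only [hI.apply_apply, map_neg, inner_neg_right] at h2
    simp only [B, LinearMap.sub_apply, LinearMap.comp_apply, LinearEquiv.coe_coe, inner_sub_left]
    linarith
  rw [LinearMap.det_comp, det_adjoint] at hpos
  by_contra hcon
  nlinarith [mul_nonneg (neg_nonneg.2 (not_lt.1 hcon)) hB]

end Inner

/-! ### Normal form of a nondegenerate alternating form -/

section Darboux

/-- Two vectors with `ω x y = 1` span a hyperbolic plane, and the space is the sum of this plane and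
its `ω`-complement. -/
theorem exists_hyperbolic_split {V : Type*} [AddCommGroup V] [Module ℝ V] [Nontrivial V]
    (ω : V →ₗ[ℝ] V →ₗ[ℝ] ℝ) (ha : ∀ x, ω x x = 0) (hn : ∀ x, (∀ y, ω x y = 0) → x = 0) :
    ∃ (U : Submodule ℝ V) (d : V ≃ₗ[ℝ] (ℝ × ℝ) × U), ∀ v w,
      ω v w = (d v).1.1 * (d w).1.2 - (d v).1.2 * (d w).1.1 + ω (d v).2 (d w).2 := by
  have hsk : ∀ x y, ω x y = -ω y x := fun x y => by
    have := ha (x + y)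
    simp only [map_add, LinearMap.add_apply, ha] at this
    linarith
  obtain ⟨x, hx⟩ := exists_ne (0 : V)
  obtain ⟨z, hz⟩ : ∃ z, ω x z ≠ 0 := by
    by_contra! h
    exact hx (hn x h)
  obtain ⟨y, hy⟩ : ∃ y, ω x y = 1 := ⟨(ω x z)⁻¹ • z, by simp [hz]⟩
  have hyx : ω y x = -1 := by rw [hsk, hy]
  let U : Submodule ℝ V := LinearMap.ker (ω x) ⊓ LinearMap.ker (ω y)
  -- The projection onto `U` along the plane spanned by `x` and `y`.
  let p : V →ₗ[ℝ] V := LinearMap.id + (ω y).smulRight x - (ω x).smulRight y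
  have hp : ∀ v, p v ∈ U := fun v => by
    simp [U, p, ha, hy, hyx]
  let d : V ≃ₗ[ℝ] (ℝ × ℝ) × U := LinearEquiv.ofLinearMap
    (((-ω y).prod (ω x)).prod (p.codRestrict U hp))
    (LinearMap.coprod (LinearMap.coprod (LinearMap.toSpanSingleton ℝ V x)
      (LinearMap.toSpanSingleton ℝ V y)) U.subtype)
    (by
      refine LinearMap.ext fun ⟨⟨a, b⟩, u⟩ => ?_
      have hu : ω x u = 0 ∧ ω y u = 0 := u.2
      refine Prod.ext (Prod.ext ?_ ?_) (Subtype.ext ?_)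
      · simp [ha, hyx, hu.2]
      · simp [ha, hy, hu.1]
      · simp [p, ha, hy, hyx, hu.1, hu.2])
    (by
      refine LinearMap.ext fun v => ?_
      simp [p])
  refine ⟨U, d, fun v w => ?_⟩
  simp only [d, p, LinearEquiv.coe_ofLinearMap, LinearMap.prod_apply, Function.prod,
    LinearMap.neg_apply, LinearMap.codRestrict_apply, map_sub, map_add, LinearMap.sub_apply,
    LinearMap.add_apply, LinearMap.id_apply, LinearMap.smulRight_apply, map_smul,
    LinearMap.smul_apply, smul_eq_mul, ha, hy, hyx]
  rw [hsk v x, hsk v y]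
  ring

/-- Induction on the dimension, splitting a hyperbolic plane off both spaces. This provides the
invertible `C` whose determinant sign is studied below. -/
theorem exists_linearEquiv_of_alternating {n : ℕ} {V W : Type*} [AddCommGroup V] [Module ℝ V]
    [FiniteDimensional ℝ V] [AddCommGroup W] [Module ℝ W] [FiniteDimensional ℝ W]
    (hV : Module.finrank ℝ V = n) (hW : Module.finrank ℝ W = n)
    (ω : V →ₗ[ℝ] V →ₗ[ℝ] ℝ) (ha : ∀ x, ω x x = 0) (hn : ∀ x, (∀ y, ω x y = 0) → x = 0)
    (ω' : W →ₗ[ℝ] W →ₗ[ℝ] ℝ) (ha' : ∀ x, ω' x x = 0) (hn' : ∀ x, (∀ y, ω' x y = 0) → x = 0) :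
    ∃ e : V ≃ₗ[ℝ] W, ∀ x y, ω' (e x) (e y) = ω x y := by
  induction n using Nat.strong_induction_on generalizing V W with
  | _ n ih =>
  rcases Nat.eq_zero_or_pos n with rfl | hpos
  · have := Module.finrank_zero_iff.1 hV
    refine ⟨LinearEquiv.ofFinrankEq V W (hV.trans hW.symm), fun x y => ?_⟩
    simp [Subsingleton.elim x 0]
  · have : Nontrivial V := Module.nontrivial_of_finrank_pos (R := ℝ) (by omega)
    have : Nontrivial W := Module.nontrivial_of_finrank_pos (R := ℝ) (by omega)
    obtain ⟨U, d, hd⟩ := exists_hyperbolic_split ω ha hn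
    obtain ⟨U', d', hd'⟩ := exists_hyperbolic_split ω' ha' hn'
    have h1 : n = 2 + Module.finrank ℝ U := by rw [← hV, d.finrank_eq]; simp
    have h2 : n = 2 + Module.finrank ℝ U' := by rw [← hW, d'.finrank_eq]; simp
    have hU : ∀ u : U, (∀ w : U, ω u w = 0) → u = 0 := fun u hu => by
      have := hn (d.symm (0, u)) fun w => by rw [hd]; simp [hu]
      simpa using this
    have hU' : ∀ u : U', (∀ w : U', ω' u w = 0) → u = 0 := fun u hu => by
      have := hn' (d'.symm (0, u)) fun w => by rw [hd']; simp [hu]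
      simpa using this
    obtain ⟨e, he⟩ := ih (Module.finrank ℝ U) (by omega) (V := U) (W := U') rfl (by omega)
      (ω.domRestrict₁₂ U U) (fun x => ha x) hU (ω'.domRestrict₁₂ U' U') (fun x => ha' x) hU'
    refine ⟨d.trans (((LinearEquiv.refl ℝ (ℝ × ℝ)).prodCongr e).trans d'.symm), fun x y => ?_⟩
    have := he (d x).2 (d y).2
    simp only [LinearMap.domRestrict₁₂_apply] at this
    rw [hd, hd']
    simp [this]

end Darboux

/-! ### Signs of skew operators relative to a complex structure. -/

section RelSign

variable {E : Type*} [NormedAddCommGroup E] [InnerProductSpace ℝ E]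

open scoped InnerProductSpace

/-- `X = C* I C` for an invertible `C` whose determinant has the sign `ε`. -/
def HasRelSign (I X : E →ₗ[ℝ] E) (ε : ℤ) : Prop :=
  ∃ C : E ≃ₗ[ℝ] E, (∀ x y, ⟪X x, y⟫_ℝ = ⟪I (C x), C y⟫_ℝ) ∧
    (SignType.sign (LinearMap.det C.toLinearMap) : ℤ) = ε

theorem sign_det_trans (C D : E ≃ₗ[ℝ] E) :
    (SignType.sign (LinearMap.det (C.trans D).toLinearMap) : ℤ) =
      (SignType.sign (LinearMap.det C.toLinearMap) : ℤ) *
        (SignType.sign (LinearMap.det D.toLinearMap) : ℤ) := by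
  rw [LinearEquiv.coe_trans, LinearMap.det_comp, sign_mul, SignType.coe_mul, mul_comm]

theorem sign_det_symm (C : E ≃ₗ[ℝ] E) :
    (SignType.sign (LinearMap.det C.symm.toLinearMap) : ℤ) =
      (SignType.sign (LinearMap.det C.toLinearMap) : ℤ) := by
  have h := C.det_symm_mul_det
  have h0 : (LinearMap.det C.toLinearMap) ≠ 0 := fun h0 => by simp [h0] at h
  rcases lt_or_gt_of_ne h0 with h0 | h0
  · have : LinearMap.det C.symm.toLinearMap < 0 := by
      by_contra hc
      nlinarith
    rw [sign_neg h0, sign_neg this]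
  · have : 0 < LinearMap.det C.symm.toLinearMap := by
      by_contra hc
      nlinarith
    rw [sign_pos h0, sign_pos this]

theorem sign_det_mul_self (C : E ≃ₗ[ℝ] E) :
    (SignType.sign (LinearMap.det C.toLinearMap) : ℤ) *
      (SignType.sign (LinearMap.det C.toLinearMap) : ℤ) = 1 := by
  have h0 : (LinearMap.det C.toLinearMap) ≠ 0 := C.isUnit_det'.ne_zero
  rcases lt_or_gt_of_ne h0 with h0 | h0
  · simp [sign_neg h0]
  · simp [sign_pos h0]

theorem HasRelSign.trans {I I' X : E →ₗ[ℝ] E} {ε ε' : ℤ} (h : HasRelSign I I' ε)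
    (h' : HasRelSign I' X ε') : HasRelSign I X (ε * ε') := by
  obtain ⟨C, hC, rfl⟩ := h
  obtain ⟨D, hD, rfl⟩ := h'
  refine ⟨D.trans C, fun x y => by simp [hC, hD], ?_⟩
  rw [sign_det_trans, mul_comm]

theorem HasRelSign.symm {I X : E →ₗ[ℝ] E} {ε : ℤ} (h : HasRelSign I X ε) :
    HasRelSign X I ε := by
  obtain ⟨C, hC, rfl⟩ := h
  exact ⟨C.symm, fun x y => by simp [hC], sign_det_symm C⟩

/-- If `A` carries `X` to `X'`, then `C A D⁻¹` preserves the form of `I` and has positive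
determinant. So the sign of `det A` is forced, whichever `A` was chosen. -/
theorem HasRelSign.finiteFlow_eq [FiniteDimensional ℝ E] {I X X' : E →ₗ[ℝ] E} (hI : IsSkewUnit I) {ε ε' : ℤ}
    (h : HasRelSign I X ε) (h' : HasRelSign I X' ε') : finiteFlow X X' = ε * ε' := by
  obtain ⟨C, hC, rfl⟩ := h
  obtain ⟨D, hD, rfl⟩ := h'
  have hex : ∃ A : E ≃ₗ[ℝ] E,
      X' = LinearMap.adjoint A.toLinearMap ∘ₗ X ∘ₗ A.toLinearMap := by
    refine ⟨D.trans C.symm, LinearMap.ext fun x => ext_inner_right ℝ fun y => ?_⟩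
    rw [LinearMap.comp_apply, LinearMap.adjoint_inner_left]
    simp [hC, hD]
  rw [finiteFlow, dif_pos hex]
  have hA := hex.choose_spec
  set A := hex.choose
  have hA' : ∀ x y, ⟪I (D x), D y⟫_ℝ = ⟪I (C (A x)), C (A y)⟫_ℝ := fun x y => by
    rw [← hD, ← hC]
    conv_lhs => rw [hA]
    rw [LinearMap.comp_apply, LinearMap.adjoint_inner_left]
    simp
  have hpos := det_pos_of_inner_nonneg hI ((D.symm.trans A).trans C) fun x => by
    have h1 : ∀ x y, ⟪I (C (A (D.symm x))), C (A (D.symm y))⟫_ℝ = ⟪I x, y⟫_ℝ := fun x y => by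
      rw [← hA']; simp
    simp only [LinearEquiv.trans_apply, h1]
    exact real_inner_self_nonneg
  have h2 := sign_det_trans (D.symm.trans A) C
  rw [sign_det_trans D.symm A, sign_det_symm] at h2
  change (SignType.sign (LinearMap.det ((D.symm.trans A).trans C).toLinearMap) : ℤ) = _ at h2
  rw [sign_pos hpos, SignType.coe_one] at h2
  have h3 := sign_det_mul_self C
  have h4 := sign_det_mul_self D
  set a := (SignType.sign (LinearMap.det A.toLinearMap) : ℤ)
  set c := (SignType.sign (LinearMap.det C.toLinearMap) : ℤ)
  set d := (SignType.sign (LinearMap.det D.toLinearMap) : ℤ)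
  calc a = (d * d) * a * (c * c) := by rw [h3, h4]; ring
    _ = (d * a * c) * (c * d) := by ring
    _ = c * d := by rw [← h2, one_mul]

theorem exists_pullback [FiniteDimensional ℝ E] {I X : E →ₗ[ℝ] E} (hI : ∀ x, ⟪I x, x⟫_ℝ = 0) (hI' : ∀ x, I x = 0 → x = 0)
    (hX : ∀ x, ⟪X x, x⟫_ℝ = 0) (hX' : ∀ x, X x = 0 → x = 0) :
    ∃ C : E ≃ₗ[ℝ] E, ∀ x y, ⟪X x, y⟫_ℝ = ⟪I (C x), C y⟫_ℝ := by
  obtain ⟨C, hC⟩ := exists_linearEquiv_of_alternating rfl rfl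
    (innerₗ E ∘ₗ X) hX (fun x hx => hX' x (ext_inner_right ℝ fun y => by simpa using hx y))
    (innerₗ E ∘ₗ I) hI (fun x hx => hI' x (ext_inner_right ℝ fun y => by simpa using hx y))
  exact ⟨C, fun x y => (hC x y).symm⟩

theorem inner_self_eq_zero_of_skew {X : E → E} (hX : ∀ x y, ⟪X x, y⟫_ℝ = -⟪x, X y⟫_ℝ) (x : E) :
    ⟪X x, x⟫_ℝ = 0 := by
  have := hX x x
  rw [real_inner_comm (X x) x] at this
  linarith

theorem IsSkewUnit.injective [FiniteDimensional ℝ E] {I : E →ₗ[ℝ] E} (hI : IsSkewUnit I) (x : E) (h : I x = 0) :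
    x = 0 := by
  simpa [h] using hI.apply_apply x

theorem HasRelSign.one_of_inner_nonneg [FiniteDimensional ℝ E] {I X : E →ₗ[ℝ] E} (hI : IsSkewUnit I)
    (hX : ∀ x y, ⟪X x, y⟫_ℝ = -⟪x, X y⟫_ℝ) (hX' : ∀ x, X x = 0 → x = 0)
    (h : ∀ x, 0 ≤ ⟪X x, I x⟫_ℝ) : HasRelSign I X 1 := by
  obtain ⟨C, hC⟩ := exists_pullback (inner_self_eq_zero_of_skew hI.inner_left) hI.injective
    (inner_self_eq_zero_of_skew hX) hX'
  refine ⟨C, hC, ?_⟩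
  rw [sign_pos (det_pos_of_inner_nonneg hI C fun x => by rw [← hC]; exact h x), SignType.coe_one]

theorem det_one_add_comp [FiniteDimensional ℝ E] {K : Type*} [AddCommGroup K] [Module ℝ K] [FiniteDimensional ℝ K]
    (f : K →ₗ[ℝ] E) (g : E →ₗ[ℝ] K) :
    LinearMap.det (LinearMap.id + f ∘ₗ g) = LinearMap.det (LinearMap.id + g ∘ₗ f) := by
  classical
  let b := Module.finBasis ℝ E
  let c := Module.finBasis ℝ K
  rw [← LinearMap.det_toMatrix b, ← LinearMap.det_toMatrix c, map_add, map_add,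
    LinearMap.toMatrix_comp b c b, LinearMap.toMatrix_comp c b c, LinearMap.toMatrix_id,
    LinearMap.toMatrix_id, Matrix.det_one_add_mul_comm]

/-- The midpoint of two complex structures, perturbed on the kernel of their sum. -/
theorem hasRelSign_midpoint [FiniteDimensional ℝ E] {K : Type*} [NormedAddCommGroup K] [InnerProductSpace ℝ K]
    [FiniteDimensional ℝ K] {I₀ I₁ : E →ₗ[ℝ] E} (h₀ : IsSkewUnit I₀) (h₁ : IsSkewUnit I₁)
    (ι : K →ₗᵢ[ℝ] E) (hι : ∀ x, I₀ x + I₁ x = 0 ↔ ∃ k, ι k = x) {r : K →ₗ[ℝ] K} {X : E →ₗ[ℝ] E}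
    (hX : ∀ x, X x = (1 / 2 : ℝ) • (I₀ x + I₁ x) +
      ι (r (LinearMap.adjoint ι.toLinearMap x)))
    (A : K ≃ₗ[ℝ] K) (hA : ∀ x y, ⟪I₀ (ι (A x)), ι (A y)⟫_ℝ = ⟪r x, y⟫_ℝ) :
    HasRelSign I₀ X (SignType.sign (LinearMap.det A.toLinearMap) : ℤ) := by
  set p : E →ₗ[ℝ] K := LinearMap.adjoint ι.toLinearMap with hp
  have hpin : ∀ x k, ⟪p x, k⟫_ℝ = ⟪x, ι k⟫_ℝ := fun x k => by
    rw [hp, LinearMap.adjoint_inner_left]; rfl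
  have hpι : ∀ k, p (ι k) = k := fun k => ext_inner_right ℝ fun l => by
    rw [hpin, ι.inner_map_map]
  have hG : ∀ k, I₀ (ι k) + I₁ (ι k) = 0 := fun k => (hι _).2 ⟨k, rfl⟩
  have hIι : ∀ k, ∃ l, ι l = I₀ (ι k) := fun k => (hι _).1 <| by
    have h := eq_neg_of_add_eq_zero_right (hG k)
    have h2 : I₁ (I₀ (ι k)) = -I₁ (I₁ (ι k)) := by rw [h, map_neg, neg_neg]
    rw [h2, h₀.apply_apply, h₁.apply_apply]; simp
  have hIp : ∀ k, ι (p (I₀ (ι k))) = I₀ (ι k) := fun k => by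
    obtain ⟨l, hl⟩ := hIι k
    rw [← hl, hpι]
  -- The midpoint with its kernel filled by `I₀` itself: `⟪Y x, I₀ x⟫` becomes a sum of squares, so
  -- `Y` has sign `1` relative to `I₀`.
  let Y : E →ₗ[ℝ] E := (1 / 2 : ℝ) • (I₀ + I₁) + I₀ ∘ₗ ι.toLinearMap ∘ₗ p
  have hYin : ∀ x y, ⟪Y x, y⟫_ℝ =
      1 / 2 * ⟪I₀ x + I₁ x, y⟫_ℝ + ⟪I₀ (ι (p x)), ι (p y)⟫_ℝ := fun x y => by
    simp only [Y, LinearMap.add_apply, LinearMap.smul_apply, LinearMap.comp_apply,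
      inner_add_left, real_inner_smul_left]
    congr 1
    rw [LinearIsometry.coe_toLinearMap, ← hIp, ι.inner_map_map, real_inner_comm, ← hpin,
      real_inner_comm]
  have hGsk : ∀ x y, ⟪I₀ x + I₁ x, y⟫_ℝ = -⟪x, I₀ y + I₁ y⟫_ℝ := fun x y => by
    rw [inner_add_left, inner_add_right, h₀.inner_left, h₁.inner_left]; ring
  have hYI : ∀ x, ⟪Y x, I₀ x⟫_ℝ = 1 / 4 * ‖I₀ x + I₁ x‖ ^ 2 + ‖p x‖ ^ 2 := fun x => by
    have e1 : ‖I₀ x + I₁ x‖ ^ 2 = 2 * ⟪I₀ x + I₁ x, I₀ x⟫_ℝ := by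
      rw [← real_inner_self_eq_norm_sq]
      simp only [inner_add_left, inner_add_right, h₀.inner_map, h₁.inner_map]
      rw [real_inner_comm (I₀ x) (I₁ x)]
      ring
    rw [e1]
    simp only [Y, LinearMap.add_apply, LinearMap.smul_apply, LinearMap.comp_apply,
      inner_add_left, real_inner_smul_left, h₀.inner_map, LinearIsometry.coe_toLinearMap]
    have e2 : ⟪ι (p x), x⟫_ℝ = ‖p x‖ ^ 2 := by
      rw [real_inner_comm, ← hpin, real_inner_self_eq_norm_sq]
    rw [e2]
    ring
  have hY : HasRelSign I₀ Y 1 := by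
    refine HasRelSign.one_of_inner_nonneg h₀ (fun x y => ?_) (fun x hx => ?_) fun x => ?_
    · rw [real_inner_comm (Y y), hYin, hYin, hGsk, h₀.inner_left, real_inner_comm (ι (p x)),
        real_inner_comm (I₀ y + I₁ y) x]
      ring
    · have h := hYI x
      rw [hx, inner_zero_left] at h
      have a1 : ‖p x‖ ^ 2 = 0 := by nlinarith [sq_nonneg ‖I₀ x + I₁ x‖, sq_nonneg ‖p x‖]
      have a2 : ‖I₀ x + I₁ x‖ ^ 2 = 0 := by nlinarith
      obtain ⟨k, rfl⟩ := (hι x).1 (by simpa using a2)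
      rw [hpι] at a1
      have : k = 0 := by simpa using a1
      simp [this]
    · rw [hYI]; positivity
  -- `B` is `A` on the kernel and the identity on its complement, so it pulls `Y` back to `X`;
  -- Sylvester's determinant identity gives `det B = det A`.
  let B : E →ₗ[ℝ] E := LinearMap.id + ι.toLinearMap ∘ₗ ((A.toLinearMap - LinearMap.id) ∘ₗ p)
  have hdet : LinearMap.det B = LinearMap.det A.toLinearMap := by
    rw [det_one_add_comp]
    congr 1
    refine LinearMap.ext fun k => ?_
    simp [hpι]
  have hBu : IsUnit (LinearMap.det B) := by rw [hdet]; exact A.isUnit_det'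
  have hpB : ∀ x, p (B x) = A (p x) := fun x => by simp [B, hpι]
  have hGB : ∀ x, I₀ (B x) + I₁ (B x) = I₀ x + I₁ x := fun x => by
    have e : ∀ k, I₁ (ι k) = -I₀ (ι k) := fun k => eq_neg_of_add_eq_zero_right (hG k)
    simp only [B, LinearMap.add_apply, LinearMap.comp_apply, map_add, LinearMap.id_apply,
      LinearIsometry.coe_toLinearMap, e]
    abel
  have hGin : ∀ x y, ⟪I₀ x + I₁ x, B y⟫_ℝ = ⟪I₀ x + I₁ x, y⟫_ℝ := fun x y => by
    rw [hGsk, hGB, ← hGsk]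
  have hB : HasRelSign Y X (SignType.sign (LinearMap.det A.toLinearMap) : ℤ) := by
    refine ⟨LinearEquiv.ofIsUnitDet (f := B) (v := Module.finBasis ℝ E)
      (v' := Module.finBasis ℝ E) (by rwa [LinearMap.det_toMatrix]), fun x y => ?_, ?_⟩
    · simp only [LinearEquiv.ofIsUnitDet_apply]
      rw [hYin, hX, hGB, hGin, hpB, hpB, hA, inner_add_left, real_inner_smul_left,
        real_inner_comm y (ι _), ← hpin, real_inner_comm (p y)]
    · rw [← hdet]; rfl
  simpa using hY.trans hB

end RelSign

/-! ### The determinant of an involution anticommuting with a complex structure. -/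

section Involution

/-- `i` maps each eigenspace of `J` injectively into the other, so both have the same dimension `m`,
and `J` is `-1` on one and the identity modulo it. -/
theorem finrank_and_det_of_anticommute {K : Type*} [AddCommGroup K] [Module ℝ K]
    [FiniteDimensional ℝ K] {J i : K →ₗ[ℝ] K} (hJ : ∀ x, J (J x) = x) (hi : ∀ x, i (i x) = -x)
    (hJi : ∀ x, J (i x) = -i (J x)) :
    ∃ m : ℕ, Module.finrank ℝ K = 2 * m ∧ LinearMap.det J = (-1) ^ m := by
  let W := LinearMap.ker (J + LinearMap.id)
  let W' := LinearMap.ker (J - LinearMap.id)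
  have hW : ∀ x, x ∈ W ↔ J x = -x := fun x => by simp [W, add_eq_zero_iff_eq_neg]
  have hW' : ∀ x, x ∈ W' ↔ J x = x := fun x => by simp [W', sub_eq_zero]
  have e1 : Module.finrank ℝ W = Module.finrank ℝ W' := by
    have hi' : Function.Injective i := fun x y h => by
      have := congrArg i h
      rwa [hi, hi, neg_inj] at this
    apply le_antisymm
    · exact LinearMap.finrank_le_finrank_of_injective (f := i.restrict (p := W) (q := W')
        fun x hx => by rw [hW'] ; rw [hW] at hx; rw [hJi, hx, map_neg, neg_neg])
        fun x y h => Subtype.ext (hi' (congrArg Subtype.val h))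
    · exact LinearMap.finrank_le_finrank_of_injective (f := i.restrict (p := W') (q := W)
        fun x hx => by rw [hW] ; rw [hW'] at hx; rw [hJi, hx])
        fun x y h => Subtype.ext (hi' (congrArg Subtype.val h))
  have e2 : LinearMap.range (J + LinearMap.id) = W' := by
    ext x
    rw [hW', LinearMap.mem_range]
    constructor
    · rintro ⟨y, rfl⟩; simp [hJ, add_comm]
    · intro hx
      refine ⟨(1 / 2 : ℝ) • x, ?_⟩
      rw [LinearMap.add_apply, map_smul, hx, LinearMap.id_apply, ← add_smul]
      norm_num
  have e3 := LinearMap.finrank_range_add_finrank_ker (J + LinearMap.id)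
  rw [e2] at e3
  refine ⟨Module.finrank ℝ W, by change _ + Module.finrank ℝ W = _ at e3; omega, ?_⟩
  have hinv : W ≤ W.comap J := fun x hx => by
    rw [Submodule.mem_comap, hW, hJ]
    rw [hW] at hx; rw [hx, neg_neg]
  rw [LinearMap.det_eq_det_mul_det W J hinv]
  have d1 : J.restrict (p := W) (q := W) hinv = (-1 : ℝ) • LinearMap.id := by
    refine LinearMap.ext fun x => Subtype.ext ?_
    have := (hW x).1 x.2
    simp [this]
  have d2 : W.mapQ W J hinv = LinearMap.id := by
    refine LinearMap.ext fun x => ?_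
    obtain ⟨x, rfl⟩ := W.mkQ_surjective x
    simp only [Submodule.mkQ_apply, Submodule.mapQ_apply, LinearMap.id_apply]
    rw [Submodule.Quotient.eq, hW]
    simp [hJ]
  rw [d1, d2, LinearMap.det_smul]
  simp

end Involution

/-! ### Fredholm properties of the straight line. -/

section Hilbert

universe u

variable {H : Type u} [NormedAddCommGroup H] [InnerProductSpace ℝ H] [CompleteSpace H]

open scoped InnerProductSpace

theorem inner_left_of_star_eq_neg {T : H →L[ℝ] H} (hT : star T = -T) (x y : H) :
    ⟪T x, y⟫_ℝ = -⟪x, T y⟫_ℝ := by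
  rw [← ContinuousLinearMap.adjoint_inner_right, ← ContinuousLinearMap.star_eq_adjoint, hT]
  simp

namespace IsComplexStructure

variable {I I₀ I₁ : H →L[ℝ] H}

theorem inner_left (hI : IsComplexStructure I) (x y : H) : ⟪I x, y⟫_ℝ = -⟪x, I y⟫_ℝ :=
  inner_left_of_star_eq_neg hI.skew x y

theorem apply_apply (hI : IsComplexStructure I) (x : H) : I (I x) = -x := by
  have h := (Unitary.mem_iff.1 hI.isUnitary).1
  rw [hI.skew] at h
  have := congrArg (fun T : H →L[ℝ] H => -(T x)) h
  simpa using this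

theorem inner_map (hI : IsComplexStructure I) (x y : H) : ⟪I x, I y⟫_ℝ = ⟪x, y⟫_ℝ := by
  rw [hI.inner_left, hI.apply_apply, inner_neg_right, neg_neg]

theorem norm_map (hI : IsComplexStructure I) (x : H) : ‖I x‖ = ‖x‖ := by
  have := hI.inner_map x x
  rw [real_inner_self_eq_norm_sq, real_inner_self_eq_norm_sq] at this
  exact (sq_eq_sq₀ (norm_nonneg _) (norm_nonneg _)).1 this

theorem norm_add_sq (h₀ : IsComplexStructure I₀) (h₁ : IsComplexStructure I₁) (x : H) :
    ‖(I₀ + I₁) x‖ ^ 2 = 2 * ‖x‖ ^ 2 + 2 * ⟪I₀ x, I₁ x⟫_ℝ := by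
  rw [add_apply, norm_add_sq_real, h₀.norm_map, h₁.norm_map]
  ring

theorem norm_linePath_sq (h₀ : IsComplexStructure I₀) (h₁ : IsComplexStructure I₁) (t : ℝ) (x : H) :
    ‖linePath I₀ I₁ t x‖ ^ 2 =
      (1 - 2 * t) ^ 2 * ‖x‖ ^ 2 + t * (1 - t) * ‖(I₀ + I₁) x‖ ^ 2 := by
  rw [norm_add_sq h₀ h₁]
  simp only [linePath, add_apply, smul_apply]
  rw [norm_add_sq_real, norm_smul, norm_smul, h₀.norm_map, h₁.norm_map, mul_pow, mul_pow,
    Real.norm_eq_abs, Real.norm_eq_abs, sq_abs, sq_abs, real_inner_smul_left,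
    real_inner_smul_right]
  ring

theorem star_linePath (h₀ : IsComplexStructure I₀) (h₁ : IsComplexStructure I₁) (t : ℝ) :
    star (linePath I₀ I₁ t) = -linePath I₀ I₁ t := by
  rw [linePath, star_add, star_smul, star_smul, h₀.skew, h₁.skew]
  simp only [star_trivial, smul_neg, neg_add]

theorem linePath_mul_self (h₀ : IsComplexStructure I₀) (h₁ : IsComplexStructure I₁) (t : ℝ) :
    linePath I₀ I₁ t * linePath I₀ I₁ t =
      -((1 - 2 * t) ^ 2 • (1 : H →L[ℝ] H)) + (t * (1 - t)) • ((I₀ + I₁) * (I₀ + I₁)) := by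
  ext x
  simp only [linePath, mul_apply_eq_comp, add_apply,
    smul_apply, neg_apply, map_add, map_smul,
    h₀.apply_apply, h₁.apply_apply, one_apply_eq_self]
  module

end IsComplexStructure

/-- `T * -T = T T*` is invertible because its quadratic form is bounded below, and commuting factors
of a unit are units. -/
theorem isUnit_of_skew_of_le_norm {T : H →L[ℝ] H} (hT : star T = -T) {c : ℝ} (hc : 0 < c)
    (h : ∀ x, c * ‖x‖ ^ 2 ≤ ‖T x‖ ^ 2) : IsUnit T := by
  have hN : IsUnit (T * -T) := by
    refine ContinuousLinearMap.isUnit_of_forall_le_norm_inner_map _ (c := ⟨c, hc.le⟩) hc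
      fun x => ?_
    have : ⟪(T * -T) x, x⟫_ℝ = ‖T x‖ ^ 2 := by
      rw [mul_apply_eq_comp, inner_left_of_star_eq_neg hT]
      simp
    rw [this, Real.norm_of_nonneg (sq_nonneg _), mul_comm]
    exact h x
  have hcomm : Commute T (-T) := (Commute.refl T).neg_right
  exact (hcomm.isUnit_mul_iff.1 hN).1

open ContinuousLinearMap in
/-- A skew-adjoint operator with finite-dimensional kernel that is bounded below on the orthogonal
complement of its kernel is Fredholm. -/
theorem isFredholm_of_skew_of_le_norm {T : H →L[ℝ] H} (hT : star T = -T) {c : ℝ} (hc : 0 < c)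
    (K : Submodule ℝ H) [FiniteDimensional ℝ K] (hK : ∀ x ∈ K, T x = 0)
    (h : ∀ x ∈ Kᗮ, c * ‖x‖ ^ 2 ≤ ‖T x‖ ^ 2) : T.IsFredholm := by
  set P : H →L[ℝ] H := K.starProjection with hP
  have hTP : T * P = 0 := by
    ext x
    exact hK _ (K.starProjection_apply_mem x)
  have hPs : star P = P := isSelfAdjoint_starProjection K
  have hPT : P * T = 0 := by
    have := congrArg star hTP
    rw [star_mul, hPs, hT, star_zero, mul_neg, neg_eq_zero] at this
    exact this
  have hPP : P * P = P := K.isIdempotentElem_starProjection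
  -- Adding `P` repairs the kernel: `N` is invertible and commutes with `T`, so `N⁻¹ (-T)` inverts
  -- `T` on both sides up to the finite-rank operator `N⁻¹ P`.
  let N : H →L[ℝ] H := T * -T + P
  have hN : IsUnit N := by
    refine ContinuousLinearMap.isUnit_of_forall_le_norm_inner_map _
      (c := ⟨min c 1, (lt_min hc one_pos).le⟩) (lt_min hc one_pos) fun x => ?_
    have h1 : ⟪N x, x⟫_ℝ = ‖T x‖ ^ 2 + ‖P x‖ ^ 2 := by
      have e : ⟪P x, x⟫_ℝ = ‖P x‖ ^ 2 := by
        conv_lhs => rw [← hPP]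
        rw [mul_apply_eq_comp, hP, K.inner_starProjection_left_eq_right, real_inner_self_eq_norm_sq]
      simp only [N, add_apply, inner_add_left, mul_apply_eq_comp, e]
      rw [inner_left_of_star_eq_neg hT]
      simp
    have h2 : T x = T (x - P x) := by
      rw [map_sub, hK (P x) (K.starProjection_apply_mem x), sub_zero]
    have h3 := h (x - P x) (K.sub_starProjection_mem_orthogonal x)
    have h4 : ‖x‖ ^ 2 = ‖x - P x‖ ^ 2 + ‖P x‖ ^ 2 := by
      have : ⟪x - P x, P x⟫_ℝ = 0 :=
        K.starProjection_inner_eq_zero x _ (K.starProjection_apply_mem x)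
      conv_lhs => rw [← sub_add_cancel x (P x)]
      rw [norm_add_sq_real, this]
      ring
    rw [h1, Real.norm_of_nonneg (by positivity), h4, h2]
    change _ * min c 1 ≤ _
    nlinarith [min_le_left c 1, min_le_right c 1, sq_nonneg ‖x - P x‖, sq_nonneg ‖P x‖,
      mul_le_mul_of_nonneg_left (min_le_left c 1) (sq_nonneg ‖x - P x‖),
      mul_le_mul_of_nonneg_left (min_le_right c 1) (sq_nonneg ‖P x‖)]
  obtain ⟨N', hN'⟩ := hN
  have hNT : Commute N T := by
    rw [Commute, SemiconjBy]
    simp only [N, add_mul, mul_add, hPT, hTP, mul_assoc]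
    simp
  have hNT' : Commute (↑N'⁻¹ : H →L[ℝ] H) T := by
    rw [← hN'] at hNT
    exact hNT.units_inv_left
  have hP' : (P : H →ₗ[ℝ] H).HasFiniteRange := by
    change (LinearMap.range (P : H →ₗ[ℝ] H)).FG
    rw [show LinearMap.range (P : H →ₗ[ℝ] H) = K from K.range_starProjection]
    exact Module.Finite.iff_fg.1 inferInstance
  have e1 : (↑N'⁻¹ * -T) * T = 1 - ↑N'⁻¹ * P := by
    have : T * -T = ↑N' - P := by rw [hN']; simp [N]
    rw [mul_assoc, neg_mul, ← mul_neg, this, mul_sub, Units.inv_mul]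
  have e2 : T * (↑N'⁻¹ * -T) = 1 - ↑N'⁻¹ * P := by
    rw [← e1, ← mul_assoc, ← hNT'.eq, mul_assoc, mul_assoc, mul_neg, neg_mul]
  refine IsFredholm.of_isQuasiInverse (v := ↑N'⁻¹ * -T) ⟨?_, ?_⟩
  · refine LinearMap.FiniteRangeSetoid.equiv_iff_hasFiniteRange.2 ?_
    have : ((↑N'⁻¹ * -T : H →L[ℝ] H) : H →ₗ[ℝ] H) ∘ₗ (T : H →ₗ[ℝ] H) - LinearMap.id =
        (-↑N'⁻¹ : H →L[ℝ] H).toLinearMap ∘ₗ (P : H →ₗ[ℝ] H) := by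
      refine LinearMap.ext fun x => ?_
      have := congrArg (fun T : H →L[ℝ] H => T x - x) e1
      simpa using this
    rw [this]
    exact hP'.comp_left _
  · refine LinearMap.FiniteRangeSetoid.equiv_iff_hasFiniteRange.2 ?_
    have : (T : H →ₗ[ℝ] H) ∘ₗ ((↑N'⁻¹ * -T : H →L[ℝ] H) : H →ₗ[ℝ] H) - LinearMap.id =
        (-↑N'⁻¹ : H →L[ℝ] H).toLinearMap ∘ₗ (P : H →ₗ[ℝ] H) := by
      refine LinearMap.ext fun x => ?_
      have := congrArg (fun T : H →L[ℝ] H => T x - x) e2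
      simpa using this
    rw [this]
    exact hP'.comp_left _

/-- Up to the factor `-I₀`, the sum of a Fredholm pair is a compact perturbation of an invertible
operator. -/
theorem exists_isUnit_add_compact {I₀ I₁ : H →L[ℝ] H} (h₀ : IsComplexStructure I₀)
    (h : calkinNorm (I₀ - I₁) < 2) :
    ∃ M C : H →L[ℝ] H, IsUnit M ∧ IsCompactOperator C ∧ -(I₀ * (I₀ + I₁)) = M + C := by
  -- `D` represents the Calkin class of `I₀ - I₁` with operator norm below `2`. Since `-I₀(I₀ + I₁)
  -- = 2 + I₀(I₀ - I₁)`, replacing `I₀ - I₁` by `D` costs a compact term and leaves a perturbation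
  -- of `2` of norm less than `2`.
  obtain ⟨D, hD, hD2⟩ := Submodule.Quotient.norm_mk_lt
    (Submodule.Quotient.mk (I₀ - I₁) : (H →L[ℝ] H) ⧸ compactOperator (RingHom.id ℝ) H H)
    (sub_pos.2 h)
  rw [← sub_eq_zero, ← Submodule.Quotient.mk_sub, Submodule.Quotient.mk_eq_zero] at hD
  have hD2' : ‖D‖ < 2 := by
    have : ‖(Submodule.Quotient.mk (I₀ - I₁) :
      (H →L[ℝ] H) ⧸ compactOperator (RingHom.id ℝ) H H)‖ = calkinNorm (I₀ - I₁) := rfl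
    rw [this] at hD2
    linarith
  refine ⟨(2 : ℝ) • 1 + I₀ * D, -(I₀ * (D - (I₀ - I₁))), ?_, ?_, ?_⟩
  · refine ContinuousLinearMap.isUnit_of_forall_le_norm_inner_map _
      (c := ⟨2 - ‖D‖, by linarith⟩) (show 0 < 2 - ‖D‖ by linarith) fun x => ?_
    refine le_trans ?_ (le_abs_self _)
    change ‖x‖ ^ 2 * (2 - ‖D‖) ≤ _
    simp only [add_apply, smul_apply,
      one_apply_eq_self, mul_apply_eq_comp, inner_add_left,
      real_inner_smul_left, real_inner_self_eq_norm_sq]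
    have h1 : |⟪I₀ (D x), x⟫_ℝ| ≤ ‖D‖ * ‖x‖ * ‖x‖ :=
      (abs_real_inner_le_norm _ _).trans (by rw [h₀.norm_map]; gcongr; exact D.le_opNorm x)
    nlinarith [neg_abs_le ⟪I₀ (D x), x⟫_ℝ]
  · have : IsCompactOperator (I₀ * (D - (I₀ - I₁)) : H →L[ℝ] H) :=
      IsCompactOperator.clm_comp (f := (D - (I₀ - I₁) : H →L[ℝ] H)) hD I₀
    exact this.neg
  · ext x
    simp only [add_apply, smul_apply,
      one_apply_eq_self, mul_apply_eq_comp,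
      neg_apply, sub_apply, map_add, map_sub,
      h₀.apply_apply]
    module

/-- On the kernel `M x = -C x`, so the identity there is the restriction of the compact operator
`-M⁻¹ C`. -/
theorem finiteDimensional_ker_add {I₀ I₁ : H →L[ℝ] H} (h₀ : IsComplexStructure I₀)
    (h : calkinNorm (I₀ - I₁) < 2) :
    FiniteDimensional ℝ (LinearMap.ker (I₀ + I₁ : H →L[ℝ] H).toLinearMap) := by
  obtain ⟨_, C, ⟨M, rfl⟩, hC, hMC⟩ := exists_isUnit_add_compact h₀ h
  set K := LinearMap.ker (I₀ + I₁ : H →L[ℝ] H).toLinearMap with hK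
  let F : H →L[ℝ] H := -(↑M⁻¹ * C)
  have hF : IsCompactOperator F :=
    (IsCompactOperator.clm_comp (f := C) hC (↑M⁻¹ : H →L[ℝ] H)).neg
  have hFx : ∀ x ∈ K, F x = x := fun x hx => by
    have h1 := congrArg (fun T : H →L[ℝ] H => (↑M⁻¹ : H →L[ℝ] H) (T x)) hMC
    have h2 : (I₀ + I₁) x = 0 := hx
    have h3 : (↑M⁻¹ : H →L[ℝ] H) ((M : H →L[ℝ] H) x) = x := by
      rw [← mul_apply_eq_comp, Units.inv_mul]; rfl
    simp only [neg_apply, mul_apply_eq_comp, h2, map_zero,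
      neg_zero, add_apply, map_add, h3] at h1
    simp only [F, neg_apply, mul_apply_eq_comp]
    exact (eq_neg_of_add_eq_zero_left h1.symm).symm
  have hcl : IsClosed (K : Set H) := (I₀ + I₁ : H →L[ℝ] H).isClosed_ker
  have hR := IsCompactOperator.restrict (f := F.toLinearMap) hF
    (V := K) (fun x hx => by change F x ∈ K; rw [hFx x hx]; exact hx) hcl
  refine FiniteDimensional.of_isCompactOperator_id (𝕜 := ℝ) ?_
  have hid : (id : K → K) = F.toLinearMap.restrict (p := K) (q := K)
      (fun x hx => by change F x ∈ K; rw [hFx x hx]; exact hx) :=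
    funext fun x => Subtype.ext (hFx x x.2).symm
  rw [hid]
  exact hR

open Filter Topology in
-- Otherwise there are unit vectors `xₙ` in the complement with `(I₀ + I₁) xₙ → 0`. Solving for `xₙ`
-- through `M⁻¹` and using compactness of `C`, a subsequence converges to a unit vector lying both
-- in the kernel and in its complement.
theorem exists_le_norm_add {I₀ I₁ : H →L[ℝ] H} (h₀ : IsComplexStructure I₀)
    (h : calkinNorm (I₀ - I₁) < 2) :
    ∃ c > 0, ∀ x ∈ (LinearMap.ker (I₀ + I₁ : H →L[ℝ] H).toLinearMap)ᗮ,
      c * ‖x‖ ≤ ‖(I₀ + I₁) x‖ := by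
  obtain ⟨_, C, ⟨M, rfl⟩, hC, hMC⟩ := exists_isUnit_add_compact h₀ h
  set K := LinearMap.ker (I₀ + I₁ : H →L[ℝ] H).toLinearMap with hK
  by_contra! hcon
  have hx : ∀ n : ℕ, ∃ x ∈ Kᗮ, ‖x‖ = 1 ∧ ‖(I₀ + I₁) x‖ < 1 / ((n : ℝ) + 1) := fun n => by
    obtain ⟨x, hx, hlt⟩ := hcon (1 / ((n : ℝ) + 1)) Nat.one_div_pos_of_nat
    have hx0 : x ≠ 0 := by rintro rfl; simp at hlt
    have hpos : 0 < ‖x‖ := norm_pos_iff.2 hx0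
    refine ⟨‖x‖⁻¹ • x, Submodule.smul_mem _ _ hx, by simp [norm_smul, hpos.ne'], ?_⟩
    rw [map_smul, norm_smul, norm_inv, norm_norm, inv_mul_lt_iff₀ hpos, mul_comm ‖x‖]
    exact hlt
  choose x hxK hx1 hxn using hx
  have hG : Tendsto (fun n => (I₀ + I₁) (x n)) atTop (𝓝 0) :=
    squeeze_zero_norm (fun n => (hxn n).le) tendsto_one_div_add_atTop_nhds_zero_nat
  obtain ⟨S, hS, hS'⟩ := IsCompactOperator.image_closedBall_subset_compact (f := C.toLinearMap)
    hC 1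
  obtain ⟨y, -, φ, hφ, hy⟩ := hS.tendsto_subseq (x := fun n => C (x n))
    fun n => hS' ⟨x n, by simp [hx1], rfl⟩
  have hxe : ∀ n, x n = (↑M⁻¹ : H →L[ℝ] H) (-(I₀ ((I₀ + I₁) (x n))) - C (x n)) := fun n => by
    have h1 : -(I₀ ((I₀ + I₁) (x n))) = (M : H →L[ℝ] H) (x n) + C (x n) :=
      congrArg (fun T : H →L[ℝ] H => T (x n)) hMC
    rw [h1, add_sub_cancel_right, ← mul_apply_eq_comp, Units.inv_mul]; rfl
  have hlim : Tendsto (fun n => x (φ n)) atTop (𝓝 ((↑M⁻¹ : H →L[ℝ] H) (-(I₀ 0) - y))) := by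
    have h1 : Tendsto (fun n => -(I₀ ((I₀ + I₁) (x (φ n)))) - C (x (φ n))) atTop
        (𝓝 (-(I₀ 0) - y)) :=
      (((I₀.continuous.tendsto 0).comp (hG.comp hφ.tendsto_atTop)).neg).sub hy
    have h2 := ((↑M⁻¹ : H →L[ℝ] H).continuous.tendsto _).comp h1
    refine h2.congr fun n => ?_
    exact (hxe (φ n)).symm
  set z := (↑M⁻¹ : H →L[ℝ] H) (-(I₀ 0) - y)
  have hz1 : ‖z‖ = 1 := tendsto_nhds_unique hlim.norm (by simp [hx1])
  have hzG : (I₀ + I₁) z = 0 := tendsto_nhds_unique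
    (((I₀ + I₁).continuous.tendsto z).comp hlim) (hG.comp hφ.tendsto_atTop)
  have hzK : z ∈ Kᗮ := K.isClosed_orthogonal.mem_of_tendsto hlim
    (Eventually.of_forall fun n => hxK _)
  have : ⟪z, z⟫_ℝ = 0 := (K.mem_orthogonal z).1 hzK z hzG
  rw [real_inner_self_eq_norm_sq, hz1] at this
  norm_num at this

end Hilbert

/-! ### Rigidity of the spectral projections along the line. -/

section Spectral

universe u

variable {H : Type u} [NormedAddCommGroup H] [InnerProductSpace ℝ H] [CompleteSpace H]

open scoped InnerProductSpace

theorem IsStarProjection.apply_apply {Q : H →L[ℝ] H} (hQ : IsStarProjection Q) (x : H) :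
    Q (Q x) = Q x :=
  congrArg (fun T : H →L[ℝ] H => T x) hQ.isIdempotentElem.eq

theorem IsStarProjection.inner_left {Q : H →L[ℝ] H} (hQ : IsStarProjection Q) (x y : H) :
    ⟪Q x, y⟫_ℝ = ⟪x, Q y⟫_ℝ := by
  rw [← ContinuousLinearMap.adjoint_inner_right, ← ContinuousLinearMap.star_eq_adjoint,
    hQ.isSelfAdjoint.star_eq]

theorem IsStarProjection.apply_coe {Q : H →L[ℝ] H} (hQ : IsStarProjection Q) (x : ran Q) :
    Q (x : H) = x := by
  obtain ⟨_, y, rfl⟩ := x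
  exact IsStarProjection.apply_apply hQ y

theorem IsStarProjection.mem_ran {Q : H →L[ℝ] H} {x : H} (hx : Q x = x) : x ∈ ran Q := ⟨x, hx⟩

/-- Commuting projections at distance less than `1` coincide. -/
theorem IsStarProjection.eq_of_norm_sub_lt {Q Q' : H →L[ℝ] H} (hQ : IsStarProjection Q)
    (hQ' : IsStarProjection Q') (hc : Commute Q Q') (h : ‖Q - Q'‖ < 1) : Q = Q' := by
  -- The difference of commuting projections equals its own cube, so its norm is at most the cube of
  -- its norm.
  have e : (Q - Q') * ((Q - Q') * (Q - Q')) = Q - Q' := by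
    have h1 : Q * Q = Q := hQ.isIdempotentElem
    have h2 : Q' * Q' = Q' := hQ'.isIdempotentElem
    have h3 : Q' * Q = Q * Q' := hc.eq.symm
    have h4 : Q * (Q * Q') = Q * Q' := by rw [← mul_assoc, h1]
    have h5 : Q' * (Q * Q') = Q * Q' := by rw [← mul_assoc, h3, mul_assoc, h2]
    simp only [sub_mul, mul_sub, h1, h2, h3, h4, h5]
    abel
  have h1 : ‖Q - Q'‖ ≤ ‖Q - Q'‖ * (‖Q - Q'‖ * ‖Q - Q'‖) := by
    conv_lhs => rw [← e]
    exact (norm_mul_le _ _).trans (by gcongr; exact norm_mul_le _ _)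
  have h2 : ‖Q - Q'‖ = 0 := by
    by_contra h0
    have hpos := lt_of_le_of_ne (norm_nonneg (Q - Q')) (Ne.symm h0)
    nlinarith [mul_lt_mul_of_pos_left h hpos]
  exact sub_eq_zero.1 (norm_eq_zero.1 h2)

variable {I₀ I₁ : H →L[ℝ] H}

/-- An isometry has `1` as its only singular value, so the threshold `a` keeps everything or
nothing. This covers the endpoints of the line, where `T_t² = -1` carries no information on `G²`. -/
theorem IsSpectralProjection.eq_zero_or_one {T Q : H →L[ℝ] H} {a : ℝ}
    (hQ : IsSpectralProjection T a Q) (hT : ∀ x, ‖T x‖ = ‖x‖) : Q = 0 ∨ Q = 1 := by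
  by_cases h : ∃ x, Q x ≠ 0
  · right
    obtain ⟨x, hx⟩ := h
    have h1 := hQ.lt_on_range (Q x) (IsStarProjection.apply_apply hQ.isStarProjection x) hx
    rw [hT] at h1
    have ha : 1 < a := by
      have := norm_pos_iff.2 hx
      by_contra hc
      nlinarith
    ext y
    have h2 := hQ.le_on_ker (y - Q y)
      (by rw [map_sub, IsStarProjection.apply_apply hQ.isStarProjection, sub_self])
    rw [hT] at h2
    have h3 : ‖y - Q y‖ = 0 := by nlinarith [norm_nonneg (y - Q y)]
    exact (sub_eq_zero.1 (norm_eq_zero.1 h3)).symm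
  · left
    push Not at h
    ext x
    simpa using h x

theorem linePath_zero : linePath I₀ I₁ 0 = I₀ := by simp [linePath]

theorem linePath_one : linePath I₀ I₁ 1 = I₁ := by simp [linePath]

/-- For `0 < s < 1` the operator `(I₀ + I₁)²` is a polynomial in the square of `linePath I₀ I₁ s`;
the endpoints are separate. -/
theorem IsSpectralProjection.commute_sq (h₀ : IsComplexStructure I₀)
    (h₁ : IsComplexStructure I₁) {s a : ℝ} {Q : H →L[ℝ] H} (hs : s ∈ Set.Icc (0 : ℝ) 1)
    (hQ : IsSpectralProjection (linePath I₀ I₁ s) a Q) :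
    Commute Q ((I₀ + I₁) * (I₀ + I₁)) := by
  rcases hs.1.eq_or_lt with rfl | h0
  · rcases hQ.eq_zero_or_one (by rw [linePath_zero]; exact h₀.norm_map) with rfl | rfl
    · exact Commute.zero_left _
    · exact Commute.one_left _
  rcases hs.2.eq_or_lt with rfl | h1
  · rcases hQ.eq_zero_or_one (by rw [linePath_one]; exact h₁.norm_map) with rfl | rfl
    · exact Commute.zero_left _
    · exact Commute.one_left _
  have hc := hQ.commute.mul_right hQ.commute
  have hne : s * (1 - s) ≠ 0 := (mul_pos h0 (sub_pos.2 h1)).ne'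
  have e : (I₀ + I₁) * (I₀ + I₁) = (s * (1 - s))⁻¹ • (linePath I₀ I₁ s * linePath I₀ I₁ s +
      (1 - 2 * s) ^ 2 • (1 : H →L[ℝ] H)) := by
    rw [IsComplexStructure.linePath_mul_self h₀ h₁, neg_add_cancel_comm, smul_smul,
      inv_mul_cancel₀ hne, one_smul]
  rw [e]
  exact (hc.add_right ((Commute.one_right Q).smul_right _)).smul_right _

/-- The finite-dimensional `ran Q` has a basis of eigenvectors of `(I₀ + I₁)²`, and `Q'` fixes or
kills each of them, so `Q'` preserves `ran Q`. Taking adjoints then shows that `Q` and `Q'` commute.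
-/
theorem IsSpectralProjection.mul_eq_of_finiteDimensional (h₀ : IsComplexStructure I₀)
    (h₁ : IsComplexStructure I₁) {s s' a : ℝ} {Q Q' : H →L[ℝ] H} (ha : 0 < a)
    (hs : s ∈ Set.Icc (0 : ℝ) 1) (hs' : s' ∈ Set.Icc (0 : ℝ) 1)
    (hQ : IsSpectralProjection (linePath I₀ I₁ s) a Q)
    (hQ' : IsSpectralProjection (linePath I₀ I₁ s') a Q') [FiniteDimensional ℝ (ran Q)] :
    Q * Q' * Q = Q' * Q := by
  set S : H →L[ℝ] H := (I₀ + I₁) * (I₀ + I₁) with hS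
  have hGs : star (I₀ + I₁) = -(I₀ + I₁) := by
    rw [star_add, h₀.skew, h₁.skew, neg_add]
  have hSx : ∀ x, ⟪S x, x⟫_ℝ = -‖(I₀ + I₁) x‖ ^ 2 := fun x => by
    rw [hS, mul_apply_eq_comp, inner_left_of_star_eq_neg hGs, real_inner_self_eq_norm_sq]
  have hc := hQ.commute_sq h₀ h₁ hs
  have hc' := hQ'.commute_sq h₀ h₁ hs'
  have hcx : ∀ x, Q (S x) = S (Q x) := fun x => congrArg (fun T : H →L[ℝ] H => T x) hc.eq
  have hcx' : ∀ x, Q' (S x) = S (Q' x) := fun x => congrArg (fun T : H →L[ℝ] H => T x) hc'.eq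
  let S' : ran Q →ₗ[ℝ] ran Q := S.toLinearMap.restrict (p := ran Q) (q := ran Q) fun x hx => by
    refine ⟨S x, ?_⟩
    change Q (S x) = S x
    rw [hcx, IsStarProjection.apply_coe hQ.isStarProjection ⟨x, hx⟩]
  have hS' : S'.IsSymmetric := fun x y => by
    change ⟪(I₀ + I₁) ((I₀ + I₁) (x : H)), (y : H)⟫_ℝ = ⟪(x : H), (I₀ + I₁) ((I₀ + I₁) (y : H))⟫_ℝ
    rw [inner_left_of_star_eq_neg hGs, inner_left_of_star_eq_neg hGs, neg_neg]
  -- `Q' v` and `v - Q' v` are eigenvectors for the same `μ`, so the path operator at `s'` stretches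
  -- both by the same factor. If neither vanished, that factor would be both below `a` and at least
  -- `a`.
  have key : ∀ (μ : ℝ) (v : H), S v = μ • v → Q' v = v ∨ Q' v = 0 := by
    intro μ v hv
    have hnorm : ∀ w, S w = μ • w → ‖linePath I₀ I₁ s' w‖ ^ 2 =
        ((1 - 2 * s') ^ 2 - s' * (1 - s') * μ) * ‖w‖ ^ 2 := fun w hw => by
      have := hSx w
      rw [hw, real_inner_smul_left, real_inner_self_eq_norm_sq] at this
      rw [IsComplexStructure.norm_linePath_sq h₀ h₁]
      linear_combination (s' * (1 - s')) * this
    by_contra! hcon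
    have e1 : S (Q' v) = μ • Q' v := by rw [← hcx', hv, map_smul]
    have e2 : S (v - Q' v) = μ • (v - Q' v) := by rw [map_sub, hv, e1, smul_sub]
    have i1 := hQ'.lt_on_range (Q' v) (IsStarProjection.apply_apply hQ'.isStarProjection v) hcon.2
    have i2 := hQ'.le_on_ker (v - Q' v)
      (by rw [map_sub, IsStarProjection.apply_apply hQ'.isStarProjection, sub_self])
    have n1 := hnorm _ e1
    have n2 := hnorm _ e2
    have p1 : 0 < ‖Q' v‖ ^ 2 := by have := norm_pos_iff.2 hcon.2; positivity
    have p2 : 0 < ‖v - Q' v‖ ^ 2 := by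
      have := norm_pos_iff.2 (sub_ne_zero.2 hcon.1.symm); positivity
    have j1 := pow_lt_pow_left₀ i1 (norm_nonneg _) two_ne_zero
    have j2 := pow_le_pow_left₀ (by positivity) i2 2
    rw [n1, mul_pow] at j1
    rw [n2, mul_pow] at j2
    have k1 := lt_of_mul_lt_mul_right j1 p1.le
    have k2 := le_of_mul_le_mul_right j2 p2
    linarith
  let b := hS'.eigenvectorBasis rfl
  have hb : ∀ i, Q (Q' (b i : H)) = Q' (b i : H) := fun i => by
    have hbi : S (b i : H) = hS'.eigenvalues rfl i • (b i : H) :=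
      congrArg Subtype.val (hS'.apply_eigenvectorBasis rfl i)
    rcases key _ _ hbi with h | h
    · rw [h, IsStarProjection.apply_coe hQ.isStarProjection]
    · rw [h, map_zero]
  have hlin : Q.toLinearMap ∘ₗ Q'.toLinearMap ∘ₗ (ran Q).subtype =
      Q'.toLinearMap ∘ₗ (ran Q).subtype := by
    refine b.toBasis.ext fun i => ?_
    simpa using hb i
  ext x
  exact LinearMap.congr_fun hlin ⟨Q x, x, rfl⟩

theorem IsSpectralProjection.eq_of_norm_sub_lt (h₀ : IsComplexStructure I₀)
    (h₁ : IsComplexStructure I₁) {s s' a : ℝ} {Q Q' : H →L[ℝ] H} (ha : 0 < a)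
    (hs : s ∈ Set.Icc (0 : ℝ) 1) (hs' : s' ∈ Set.Icc (0 : ℝ) 1)
    (hQ : IsSpectralProjection (linePath I₀ I₁ s) a Q)
    (hQ' : IsSpectralProjection (linePath I₀ I₁ s') a Q') [FiniteDimensional ℝ (ran Q)]
    (h : ‖Q - Q'‖ < 1) : Q = Q' := by
  refine IsStarProjection.eq_of_norm_sub_lt hQ.isStarProjection hQ'.isStarProjection ?_ h
  have e := hQ.mul_eq_of_finiteDimensional h₀ h₁ ha hs hs' hQ'
  have e' := congrArg star e
  rw [star_mul, star_mul, star_mul, hQ.isStarProjection.isSelfAdjoint.star_eq,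
    hQ'.isStarProjection.isSelfAdjoint.star_eq, ← mul_assoc, e] at e'
  exact e'.symm

theorem IsSpectralProjection.apply_eq_self {T Q : H →L[ℝ] H} {a : ℝ} (ha : 0 < a)
    (hQ : IsSpectralProjection T a Q) {x : H} (hx : T x = 0) : Q x = x := by
  have h1 := hQ.le_on_ker (x - Q x)
    (by rw [map_sub, IsStarProjection.apply_apply hQ.isStarProjection, sub_self])
  have h2 : T (Q x) = Q (T x) := congrArg (fun T : H →L[ℝ] H => T x) hQ.commute.eq.symm
  rw [map_sub, h2, hx, map_zero, sub_zero, norm_zero] at h1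
  have h3 : ‖x - Q x‖ = 0 := by nlinarith [norm_nonneg (x - Q x)]
  exact (sub_eq_zero.1 (norm_eq_zero.1 h3)).symm

theorem linePath_half_apply (x : H) :
    linePath I₀ I₁ (1 / 2) x = (1 / 2 : ℝ) • (I₀ x + I₁ x) := by
  simp only [linePath, add_apply, smul_apply, smul_add]
  norm_num

/-- Two distinct points of a line determine its endpoints as linear combinations. -/
theorem commute_of_commute_linePath {s s' : ℝ} (hss : s ≠ s') {Q : H →L[ℝ] H}
    (h : Commute Q (linePath I₀ I₁ s)) (h' : Commute Q (linePath I₀ I₁ s')) :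
    Commute Q I₀ ∧ Commute Q I₁ := by
  have hne : s' - s ≠ 0 := sub_ne_zero.2 hss.symm
  have e₀ : I₀ = (s' - s)⁻¹ • (s' • linePath I₀ I₁ s - s • linePath I₀ I₁ s') := by
    rw [eq_inv_smul_iff₀ hne]
    simp only [linePath]
    module
  have e₁ : I₁ = (s' - s)⁻¹ • ((1 - s) • linePath I₀ I₁ s' - (1 - s') • linePath I₀ I₁ s) := by
    rw [eq_inv_smul_iff₀ hne]
    simp only [linePath]
    module
  constructor
  · rw [e₀]
    exact ((h.smul_right _).sub_right (h'.smul_right _)).smul_right _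
  · rw [e₁]
    exact ((h'.smul_right _).sub_right (h.smul_right _)).smul_right _

end Spectral

/-! ### The kernel of the sum and the action of the chiral symmetry on it. -/

section Kernel

universe u

variable {H : Type u} [NormedAddCommGroup H] [InnerProductSpace ℝ H] [CompleteSpace H]

open scoped InnerProductSpace

/-- The kernel of `I₀ + I₁`. -/
abbrev sumKer (I₀ I₁ : H →L[ℝ] H) : Submodule ℝ H :=
  LinearMap.ker (I₀ + I₁ : H →L[ℝ] H).toLinearMap

variable {J I₀ I₁ : H →L[ℝ] H}

theorem mem_sumKer {x : H} : x ∈ sumKer I₀ I₁ ↔ I₀ x + I₁ x = 0 := Iff.rfl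

theorem linePath_half_eq_zero_iff {x : H} :
    linePath I₀ I₁ (1 / 2) x = 0 ↔ x ∈ sumKer I₀ I₁ := by
  rw [linePath_half_apply, mem_sumKer, smul_eq_zero_iff_right (by norm_num)]

theorem IsComplexStructure.map_mem_sumKer (h₀ : IsComplexStructure I₀)
    (h₁ : IsComplexStructure I₁) {x : H} (hx : x ∈ sumKer I₀ I₁) : I₀ x ∈ sumKer I₀ I₁ := by
  have h : I₀ x = -I₁ x := eq_neg_of_add_eq_zero_left hx
  rw [mem_sumKer, h₀.apply_apply, h, map_neg, h₁.apply_apply]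
  simp

theorem IsSymmetry.apply_apply (hJ : IsSymmetry J) (x : H) : J (J x) = x :=
  congrArg (fun T : H →L[ℝ] H => T x) hJ.sq_eq_one

theorem IsSymmetry.anticomm (hJ : IsSymmetry J) {I : H →L[ℝ] H} (hI : J * I * J = -I) (x : H) :
    J (I x) = -I (J x) := by
  have := congrArg (fun T : H →L[ℝ] H => T (J x)) hI
  simpa [hJ.apply_apply] using this

theorem IsSymmetry.map_mem_sumKer (hJ : IsSymmetry J) (h₀ : J * I₀ * J = -I₀)
    (h₁ : J * I₁ * J = -I₁) {x : H} (hx : x ∈ sumKer I₀ I₁) : J x ∈ sumKer I₀ I₁ := by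
  rw [mem_sumKer] at hx ⊢
  have := congrArg J hx
  rw [map_add, hJ.anticomm h₀, hJ.anticomm h₁, map_zero, ← neg_add, neg_eq_zero] at this
  exact this

/-- The restriction of `I₀` to the kernel of `I₀ + I₁`. -/
def kerMap (h₀ : IsComplexStructure I₀) (h₁ : IsComplexStructure I₁) :
    sumKer I₀ I₁ →ₗ[ℝ] sumKer I₀ I₁ :=
  I₀.toLinearMap.restrict fun _ hx => h₀.map_mem_sumKer h₁ hx

/-- The restriction of a chiral symmetry to the kernel of `I₀ + I₁`. -/
def kerSymm (hJ : IsSymmetry J) (h₀ : J * I₀ * J = -I₀) (h₁ : J * I₁ * J = -I₁) :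
    sumKer I₀ I₁ ≃ₗ[ℝ] sumKer I₀ I₁ :=
  LinearEquiv.ofInvolutive (J.toLinearMap.restrict fun _ hx => hJ.map_mem_sumKer h₀ h₁ hx)
    fun x => Subtype.ext (hJ.apply_apply x)

theorem isSkewUnit_kerMap (h₀ : IsComplexStructure I₀) (h₁ : IsComplexStructure I₁)
    [FiniteDimensional ℝ (sumKer I₀ I₁)] : IsSkewUnit (kerMap h₀ h₁) where
  adjoint_eq := by
    refine LinearMap.ext fun x => ext_inner_right ℝ fun y => ?_
    rw [LinearMap.adjoint_inner_left, LinearMap.neg_apply, inner_neg_left]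
    change ⟪(x : H), I₀ y⟫_ℝ = -⟪I₀ (x : H), y⟫_ℝ
    rw [h₀.inner_left, neg_neg]
  apply_apply x := Subtype.ext (h₀.apply_apply x)

theorem kerSymm_det (hJ : IsSymmetry J) (h₀ : IsComplexStructure I₀)
    (h₁ : IsComplexStructure I₁) (hJ₀ : J * I₀ * J = -I₀) (hJ₁ : J * I₁ * J = -I₁)
    [FiniteDimensional ℝ (sumKer I₀ I₁)] :
    Even (Module.finrank ℝ (sumKer I₀ I₁)) ∧
      (SignType.sign (LinearMap.det (kerSymm hJ hJ₀ hJ₁).toLinearMap) : ℤ) =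
        z2Sign (z2Index I₀ I₁) := by
  obtain ⟨m, hm, hdet⟩ := finrank_and_det_of_anticommute
    (J := (kerSymm hJ hJ₀ hJ₁).toLinearMap) (i := kerMap h₀ h₁)
    (fun x => Subtype.ext (hJ.apply_apply x)) (isSkewUnit_kerMap h₀ h₁).apply_apply
    (fun x => Subtype.ext (hJ.anticomm hJ₀ x))
  refine ⟨⟨m, by omega⟩, ?_⟩
  have e : z2Index I₀ I₁ = (m : ZMod 2) := by
    change ((Module.finrank ℝ (sumKer I₀ I₁) / 2 : ℕ) : ZMod 2) = m
    rw [hm, Nat.mul_div_cancel_left m two_pos]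
  rw [hdet, e, z2Sign, ZMod.val_natCast, ← neg_one_pow_eq_pow_mod_two]
  rcases neg_one_pow_eq_or ℝ m with h | h
  · have hme : Even m := by
      by_contra hc
      rw [Nat.not_even_iff_odd] at hc
      rw [hc.neg_one_pow] at h
      norm_num at h
    rw [h, hme.neg_one_pow]; simp
  · have hmo : Odd m := by
      by_contra hc
      rw [Nat.not_odd_iff_even] at hc
      rw [hc.neg_one_pow] at h
      norm_num at h
    rw [h, hmo.neg_one_pow, sign_neg (by norm_num)]; rfl

end Kernel

/-! ### Compressions to the range of a reducing projection. -/

section Compression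

universe u

variable {H : Type u} [NormedAddCommGroup H] [InnerProductSpace ℝ H] [CompleteSpace H]

open scoped InnerProductSpace

variable {Q : H →L[ℝ] H}

theorem inner_compression (hQ : IsStarProjection Q) (A : H →L[ℝ] H) (x y : ran Q) :
    ⟪compression Q A x, y⟫_ℝ = ⟪A x, (y : H)⟫_ℝ := by
  change ⟪Q (A x), (y : H)⟫_ℝ = _
  rw [IsStarProjection.inner_left hQ, IsStarProjection.apply_coe hQ]

theorem coe_compression (hQ : IsStarProjection Q) {A : H →L[ℝ] H} (hA : Commute Q A)
    (x : ran Q) : (compression Q A x : H) = A x := by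
  change Q (A x) = _
  have : Q (A x) = A (Q x) := congrArg (fun T : H →L[ℝ] H => T x) hA.eq
  rw [this, IsStarProjection.apply_coe hQ]

theorem compression_skew (hQ : IsStarProjection Q) {A : H →L[ℝ] H} (hA : star A = -A)
    (x y : ran Q) : ⟪compression Q A x, y⟫_ℝ = -⟪x, compression Q A y⟫_ℝ := by
  rw [real_inner_comm _ x, inner_compression hQ, inner_compression hQ,
    inner_left_of_star_eq_neg hA, real_inner_comm]

theorem isSkewUnit_compression [FiniteDimensional ℝ (ran Q)] (hQ : IsStarProjection Q)
    {I : H →L[ℝ] H} (hI : IsComplexStructure I) (hc : Commute Q I) :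
    IsSkewUnit (compression Q I) where
  adjoint_eq := by
    refine LinearMap.ext fun x => ext_inner_right ℝ fun y => ?_
    rw [LinearMap.adjoint_inner_left, LinearMap.neg_apply, inner_neg_left,
      compression_skew hQ hI.skew, neg_neg]
  apply_apply x := Subtype.ext <| by
    rw [coe_compression hQ hc, coe_compression hQ hc, hI.apply_apply]
    rfl

theorem pieceFlow_self [FiniteDimensional ℝ (ran Q)] (hQ : IsStarProjection Q)
    (A A' : H →L[ℝ] H) :
    pieceFlow Q Q A A' = finiteFlow (compression Q A) (compression Q A') := by
  have h : transfer Q Q = LinearMap.id := by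
    refine LinearMap.ext fun x => Subtype.ext ?_
    exact IsStarProjection.apply_coe hQ x
  rw [pieceFlow, h, LinearMap.adjoint_id, LinearMap.id_comp, LinearMap.comp_id]

variable {I₀ I₁ : H →L[ℝ] H}

theorem linePath_swap (s : ℝ) : linePath I₀ I₁ s = linePath I₁ I₀ (1 - s) := by
  simp only [linePath, sub_sub_cancel]
  rw [add_comm]

theorem commute_linePath (hc₀ : Commute Q I₀) (hc₁ : Commute Q I₁) (s : ℝ) :
    Commute Q (linePath I₀ I₁ s) :=
  (hc₀.smul_right _).add_right (hc₁.smul_right _)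

/-- `⟪T_s x, I₀ x⟫ ≥ (1 - 2s)‖x‖²`, which is positive up to the midpoint. The other half follows by
exchanging the two structures with `linePath_swap`. -/
theorem hasRelSign_linePath [FiniteDimensional ℝ (ran Q)] (hQ : IsStarProjection Q)
    (h₀ : IsComplexStructure I₀) (h₁ : IsComplexStructure I₁) (hc₀ : Commute Q I₀)
    {s : ℝ} (hs0 : 0 ≤ s) (hs : s < 1 / 2) :
    HasRelSign (compression Q I₀) (compression Q (linePath I₀ I₁ s)) 1 := by
  have key : ∀ x : ran Q, (1 - 2 * s) * ‖(x : H)‖ ^ 2 ≤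
      ⟪compression Q (linePath I₀ I₁ s) x, compression Q I₀ x⟫_ℝ := fun x => by
    rw [inner_compression hQ, coe_compression hQ hc₀]
    simp only [linePath, add_apply, smul_apply, inner_add_left, real_inner_smul_left,
      h₀.inner_map, real_inner_self_eq_norm_sq]
    have h1 : |⟪I₁ (x : H), I₀ (x : H)⟫_ℝ| ≤ ‖(x : H)‖ * ‖(x : H)‖ := by
      have := abs_real_inner_le_norm (I₁ (x : H)) (I₀ (x : H))
      rwa [h₀.norm_map, h₁.norm_map] at this
    nlinarith [mul_le_mul_of_nonneg_left (neg_le_of_abs_le h1) hs0]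
  refine HasRelSign.one_of_inner_nonneg (isSkewUnit_compression hQ h₀ hc₀)
    (compression_skew hQ (IsComplexStructure.star_linePath h₀ h₁ s)) (fun x hx => ?_) fun x => ?_
  · have h := key x
    rw [hx, inner_zero_left] at h
    have h2 : ‖(x : H)‖ ^ 2 ≤ 0 := by
      by_contra hc
      nlinarith [mul_pos (show 0 < 1 - 2 * s by linarith) (not_le.1 hc)]
    have h3 : (x : H) = 0 := by
      have := sq_eq_zero_iff.1 (le_antisymm h2 (sq_nonneg _))
      exact norm_eq_zero.1 this
    exact Subtype.ext h3
  · exact le_trans (mul_nonneg (by linarith) (sq_nonneg _)) (key x)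

/-- The inclusion of the kernel of `I₀ + I₁` into the range of a projection. -/
def kerInclusion (hK : sumKer I₀ I₁ ≤ ran Q) : sumKer I₀ I₁ →ₗᵢ[ℝ] ran Q where
  toLinearMap := Submodule.inclusion hK
  norm_map' _ := rfl

theorem exists_kerInclusion_iff (hQ : IsStarProjection Q) (hc₀ : Commute Q I₀)
    (hc₁ : Commute Q I₁) (hK : sumKer I₀ I₁ ≤ ran Q) (x : ran Q) :
    compression Q I₀ x + compression Q I₁ x = 0 ↔ ∃ k, kerInclusion hK k = x := by
  rw [← Subtype.coe_inj, Submodule.coe_add, coe_compression hQ hc₀, coe_compression hQ hc₁]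
  constructor
  · intro h
    exact ⟨⟨x, h⟩, rfl⟩
  · rintro ⟨k, rfl⟩
    exact k.2

/-- The compression to `ran Q` of the midpoint of the path, perturbed on its kernel. -/
theorem hasRelSign_half [FiniteDimensional ℝ (ran Q)] [FiniteDimensional ℝ (sumKer I₀ I₁)]
    (hQ : IsStarProjection Q)
    (h₀ : IsComplexStructure I₀) (h₁ : IsComplexStructure I₁) (hc₀ : Commute Q I₀)
    (hc₁ : Commute Q I₁) (hK : sumKer I₀ I₁ ≤ ran Q) {R : H →L[ℝ] H} (hR : star R = -R)
    {r : sumKer I₀ I₁ →ₗ[ℝ] sumKer I₀ I₁} (hr : ∀ x, (r x : H) = R x)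
    (hRK : ∀ x, R x ∈ sumKer I₀ I₁) {ε : ℤ} (hε : HasRelSign (kerMap h₀ h₁) r ε) :
    HasRelSign (compression Q I₀) (compression Q (linePath I₀ I₁ (1 / 2) + R)) ε := by
  obtain ⟨A, hA, rfl⟩ := hε
  refine hasRelSign_midpoint (isSkewUnit_compression hQ h₀ hc₀) (isSkewUnit_compression hQ h₁ hc₁)
    (kerInclusion hK) (exists_kerInclusion_iff hQ hc₀ hc₁ hK) (r := r) (fun x => ?_) A
    fun x y => ?_
  · refine Subtype.ext ?_
    set p := LinearMap.adjoint (kerInclusion hK).toLinearMap x with hp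
    -- A skew operator with range in the kernel vanishes on its complement, so `R` sees only the
    -- component `p` of `x`.
    have e1 : R ((x : H) - p) = 0 := by
      refine ext_inner_right ℝ fun y => ?_
      rw [inner_left_of_star_eq_neg hR, inner_sub_left, inner_zero_left, neg_eq_zero, sub_eq_zero]
      have : ⟪p, (⟨R y, hRK y⟩ : sumKer I₀ I₁)⟫_ℝ =
          ⟪x, kerInclusion hK ⟨R y, hRK y⟩⟫_ℝ := by
        rw [hp, LinearMap.adjoint_inner_left]; rfl
      exact this.symm
    have e2 : R (x : H) = R p := by rwa [map_sub, sub_eq_zero] at e1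
    have e3 : Q (R p) = R p := by
      exact IsStarProjection.apply_coe hQ ⟨R p, hK (hRK p)⟩
    change Q ((linePath I₀ I₁ (1 / 2) + R) x) =
      (1 / 2 : ℝ) • ((compression Q I₀ x : H) + (compression Q I₁ x : H)) + (r p : H)
    rw [hr, add_apply, linePath_half_apply, map_add, e2, e3, map_smul, map_add]
    rfl
  · rw [inner_compression hQ]
    exact (hA x y).symm

/-- Both structures are compared with the midpoint `X` filled by `I₀` on the kernel. Seen from `I₀`
the filling needs no change of basis; seen from `I₁ = -I₀` it is the pullback by `J`, because `J`
anticommutes with `I₀`. This is where chirality produces the index. -/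
theorem hasRelSign_of_kerSymm [FiniteDimensional ℝ (ran Q)] [FiniteDimensional ℝ (sumKer I₀ I₁)]
    {J : H →L[ℝ] H} (hJ : IsSymmetry J) (hJ₀ : J * I₀ * J = -I₀) (hJ₁ : J * I₁ * J = -I₁)
    (hQ : IsStarProjection Q)
    (h₀ : IsComplexStructure I₀) (h₁ : IsComplexStructure I₁) (hc₀ : Commute Q I₀)
    (hc₁ : Commute Q I₁) (hK : sumKer I₀ I₁ ≤ ran Q) :
    HasRelSign (compression Q I₀) (compression Q I₁)
      (SignType.sign (LinearMap.det (kerSymm hJ hJ₀ hJ₁).toLinearMap) : ℤ) := by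
  set ι := kerInclusion hK with hι
  let X : ran Q →ₗ[ℝ] ran Q := (1 / 2 : ℝ) • (compression Q I₀ + compression Q I₁) +
    ι.toLinearMap ∘ₗ kerMap h₀ h₁ ∘ₗ LinearMap.adjoint ι.toLinearMap
  have hm := exists_kerInclusion_iff hQ hc₀ hc₁ hK
  have s₀ := isSkewUnit_compression hQ h₀ hc₀
  have s₁ := isSkewUnit_compression hQ h₁ hc₁
  have e₀ := hasRelSign_midpoint s₀ s₁ ι hm (r := kerMap h₀ h₁) (X := X) (fun _ => rfl)
    (LinearEquiv.refl ℝ _) fun x y => by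
      rw [inner_compression hQ]; rfl
  have e₁ := hasRelSign_midpoint s₁ s₀ ι (fun x => by rw [add_comm]; exact hm x)
    (r := kerMap h₀ h₁) (X := X) (fun x => by
      rw [add_comm (compression Q I₁ x)]; rfl)
    (kerSymm hJ hJ₀ hJ₁) fun x y => by
      rw [inner_compression hQ]
      change ⟪I₁ (J x), J y⟫_ℝ = ⟪I₀ x, (y : H)⟫_ℝ
      have hJx : I₁ (J x) = J (I₀ x) := by
        have := hJ.map_mem_sumKer hJ₀ hJ₁ x.2
        rw [mem_sumKer] at this
        rw [eq_neg_of_add_eq_zero_right this, hJ.anticomm hJ₀]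
      rw [hJx, ← ContinuousLinearMap.adjoint_inner_left, ← ContinuousLinearMap.star_eq_adjoint,
        hJ.selfAdjoint.star_eq, hJ.apply_apply]
  have e := e₀.trans e₁.symm
  simpa using e

end Compression

/-! ### Evaluation of the flow for arbitrary choices. -/

section Flow

universe u

variable {H : Type u} [NormedAddCommGroup H] [InnerProductSpace ℝ H] [CompleteSpace H]

open scoped InnerProductSpace

variable {J I₀ I₁ : H →L[ℝ] H}

theorem pieceFlow_of_eq {Q Q' : H →L[ℝ] H} (h : Q = Q') [FiniteDimensional ℝ (ran Q)]
    [FiniteDimensional ℝ (ran Q')] (hQ : IsStarProjection Q) (A A' : H →L[ℝ] H) :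
    pieceFlow Q Q' A A' = finiteFlow (compression Q A) (compression Q A') := by
  subst h
  exact pieceFlow_self hQ A A'

theorem linePath_injective (h₀ : IsComplexStructure I₀) (h₁ : IsComplexStructure I₁) {s : ℝ}
    (hs : s ∈ Set.Icc (0 : ℝ) 1) (hs' : s ≠ 1 / 2) {x : H} (hx : linePath I₀ I₁ s x = 0) :
    x = 0 := by
  have h := IsComplexStructure.norm_linePath_sq h₀ h₁ s x
  rw [hx, norm_zero] at h
  have h1 : 0 < (1 - 2 * s) ^ 2 := by
    have : 1 - 2 * s ≠ 0 := fun h => hs' (by linarith)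
    positivity
  have h2 : 0 ≤ s * (1 - s) * ‖(I₀ + I₁) x‖ ^ 2 :=
    mul_nonneg (mul_nonneg hs.1 (sub_nonneg.2 hs.2)) (sq_nonneg _)
  by_contra hx0
  have := mul_pos h1 (pow_pos (norm_pos_iff.2 hx0) 2)
  linarith

/-- The sign `ε` attached to the point `s` of a partition, where `R` is the perturbation on the
kernel of the path at `s` and `σ` the sign of the part of the path that follows `1 / 2`. -/
structure IsPointSign (h₀ : IsComplexStructure I₀) (h₁ : IsComplexStructure I₁) (σ : ℤ) (s : ℝ)
    (R : H →L[ℝ] H) (ε : ℤ) : Prop where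
  eq_one : s < 1 / 2 → ε = 1
  eq_of_lt : 1 / 2 < s → ε = σ
  hasRelSign : s = 1 / 2 → ∃ r : sumKer I₀ I₁ →ₗ[ℝ] sumKer I₀ I₁,
    (∀ x, (r x : H) = R x) ∧ HasRelSign (kerMap h₀ h₁) r ε
  mul_self : ε * ε = 1

theorem exists_isPointSign (h₀ : IsComplexStructure I₀) (h₁ : IsComplexStructure I₁)
    [FiniteDimensional ℝ (sumKer I₀ I₁)] {σ : ℤ} (hσ : σ * σ = 1) {s : ℝ} {R : H →L[ℝ] H}
    (hR : star R = -R) (hRr : ∀ x, linePath I₀ I₁ s (R x) = 0)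
    (hRi : ∀ x, linePath I₀ I₁ s x = 0 → R x = 0 → x = 0) :
    ∃ ε, IsPointSign h₀ h₁ σ s R ε := by
  rcases lt_trichotomy s (1 / 2) with hs | rfl | hs
  · exact ⟨1, fun _ => rfl, fun h => absurd h hs.not_gt, fun h => absurd h hs.ne, by norm_num⟩
  · let r : sumKer I₀ I₁ →ₗ[ℝ] sumKer I₀ I₁ := R.toLinearMap.restrict
      fun x _ => linePath_half_eq_zero_iff.1 (hRr x)
    have hI := isSkewUnit_kerMap h₀ h₁
    obtain ⟨A, hA⟩ := exists_pullback (X := r) (inner_self_eq_zero_of_skew hI.inner_left)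
      hI.injective
      (inner_self_eq_zero_of_skew fun x y => inner_left_of_star_eq_neg hR (x : H) y)
      fun x hx => Subtype.ext
        (hRi x (linePath_half_eq_zero_iff.2 x.2) (congrArg Subtype.val hx))
    exact ⟨_, fun h => absurd h (lt_irrefl _), fun h => absurd h (lt_irrefl _),
      fun _ => ⟨r, fun _ => rfl, A, hA, rfl⟩, sign_det_mul_self A⟩
  · exact ⟨σ, fun h => absurd h hs.not_gt, fun _ => rfl, fun h => absurd h hs.ne', hσ⟩

section Point

variable [FiniteDimensional ℝ (sumKer I₀ I₁)] {Q : H →L[ℝ] H} [FiniteDimensional ℝ (ran Q)]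

theorem hasRelSign_point (hJ : IsSymmetry J) (hJ₀ : J * I₀ * J = -I₀) (hJ₁ : J * I₁ * J = -I₁)
    (h₀ : IsComplexStructure I₀) (h₁ : IsComplexStructure I₁) (hQ : IsStarProjection Q)
    (hc₀ : Commute Q I₀) (hc₁ : Commute Q I₁) (hK : sumKer I₀ I₁ ≤ ran Q) {s : ℝ}
    (hs : s ∈ Set.Icc (0 : ℝ) 1) {R : H →L[ℝ] H} (hR : star R = -R)
    (hRr : ∀ x, linePath I₀ I₁ s (R x) = 0) {ε : ℤ}
    (hε : IsPointSign h₀ h₁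
      (SignType.sign (LinearMap.det (kerSymm hJ hJ₀ hJ₁).toLinearMap) : ℤ) s R ε) :
    HasRelSign (compression Q I₀) (compression Q (linePath I₀ I₁ s + R)) ε := by
  have hR0 : s ≠ 1 / 2 → R = 0 := fun hne =>
    ContinuousLinearMap.ext fun x => linePath_injective h₀ h₁ hs hne (hRr x)
  rcases lt_trichotomy s (1 / 2) with hs' | rfl | hs'
  · rw [hR0 hs'.ne, add_zero, hε.eq_one hs']
    exact hasRelSign_linePath hQ h₀ h₁ hc₀ hs.1 hs'
  · obtain ⟨r, hr, hrε⟩ := hε.hasRelSign rfl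
    exact hasRelSign_half hQ h₀ h₁ hc₀ hc₁ hK hR hr
      (fun x => linePath_half_eq_zero_iff.1 (hRr x)) hrε
  · rw [hR0 hs'.ne', add_zero, hε.eq_of_lt hs']
    have e := (hasRelSign_of_kerSymm hJ hJ₀ hJ₁ hQ h₀ h₁ hc₀ hc₁ hK).trans
      (hasRelSign_linePath hQ h₁ h₀ hc₁ (s := 1 - s) (by linarith [hs.2]) (by linarith))
    rwa [mul_one, ← linePath_swap] at e

/-- A piece missing `1/2` may have a range that does not contain the kernel, so its ends are
compared with the structure on their own side, `I₀` or `I₁`. Only a piece meeting `1/2` needs the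
kernel inside the range, and there both ends are compared with `I₀`. -/
theorem finiteFlow_piece (hJ : IsSymmetry J) (hJ₀ : J * I₀ * J = -I₀) (hJ₁ : J * I₁ * J = -I₁)
    (h₀ : IsComplexStructure I₀) (h₁ : IsComplexStructure I₁) (hQ : IsStarProjection Q)
    (hc₀ : Commute Q I₀) (hc₁ : Commute Q I₁) {s s' : ℝ}
    (hs : s ∈ Set.Icc (0 : ℝ) 1) (hs' : s' ∈ Set.Icc (0 : ℝ) 1) (hss : s < s')
    (hK : 1 / 2 ∈ Set.Icc s s' → sumKer I₀ I₁ ≤ ran Q) {R R' : H →L[ℝ] H}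
    (hR : star R = -R) (hR' : star R' = -R') (hRr : ∀ x, linePath I₀ I₁ s (R x) = 0)
    (hRr' : ∀ x, linePath I₀ I₁ s' (R' x) = 0) {ε ε' : ℤ}
    (hε : IsPointSign h₀ h₁
      (SignType.sign (LinearMap.det (kerSymm hJ hJ₀ hJ₁).toLinearMap) : ℤ) s R ε)
    (hε' : IsPointSign h₀ h₁
      (SignType.sign (LinearMap.det (kerSymm hJ hJ₀ hJ₁).toLinearMap) : ℤ) s' R' ε') :
    finiteFlow (compression Q (linePath I₀ I₁ s + R))
      (compression Q (linePath I₀ I₁ s' + R')) = ε * ε' := by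
  have hR0 : s ≠ 1 / 2 → R = 0 := fun hne =>
    ContinuousLinearMap.ext fun x => linePath_injective h₀ h₁ hs hne (hRr x)
  have hR0' : s' ≠ 1 / 2 → R' = 0 := fun hne =>
    ContinuousLinearMap.ext fun x => linePath_injective h₀ h₁ hs' hne (hRr' x)
  by_cases hlt : s' < 1 / 2
  · have hlt' := hss.trans hlt
    rw [hR0 hlt'.ne, hR0' hlt.ne, add_zero, add_zero, hε.eq_one hlt', hε'.eq_one hlt]
    exact (hasRelSign_linePath hQ h₀ h₁ hc₀ hs.1 hlt').finiteFlow_eq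
      (isSkewUnit_compression hQ h₀ hc₀) (hasRelSign_linePath hQ h₀ h₁ hc₀ hs'.1 hlt)
  by_cases hgt : 1 / 2 < s
  · have hgt' := hgt.trans hss
    rw [hR0 hgt.ne', hR0' hgt'.ne', add_zero, add_zero, hε.eq_of_lt hgt, hε'.eq_of_lt hgt',
      sign_det_mul_self, linePath_swap s, linePath_swap s']
    exact (hasRelSign_linePath hQ h₁ h₀ hc₁ (by linarith [hs.2]) (by linarith)).finiteFlow_eq
      (isSkewUnit_compression hQ h₁ hc₁)
      (hasRelSign_linePath hQ h₁ h₀ hc₁ (by linarith [hs'.2]) (by linarith))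
  have hK' := hK ⟨not_lt.1 hgt, not_lt.1 hlt⟩
  exact (hasRelSign_point hJ hJ₀ hJ₁ h₀ h₁ hQ hc₀ hc₁ hK' hs hR hRr hε).finiteFlow_eq
    (isSkewUnit_compression hQ h₀ hc₀)
    (hasRelSign_point hJ hJ₀ hJ₁ h₀ h₁ hQ hc₀ hc₁ hK' hs' hR' hRr' hε')

end Point

/-- Every interior sign occurs twice; this removes the dependence on the perturbation at `1/2`. -/
theorem prod_castSucc_mul_succ {N : ℕ} (ε : Fin (N + 1) → ℤ) (h : ∀ n, ε n * ε n = 1) :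
    ∏ n : Fin N, ε n.castSucc * ε n.succ = ε 0 * ε (Fin.last N) := by
  have hP : (∏ n, ε n) * ∏ n, ε n = 1 := by
    rw [← Finset.prod_mul_distrib]
    exact Finset.prod_eq_one fun n _ => h n
  have e1 := Fin.prod_univ_succ ε
  have e2 := Fin.prod_univ_castSucc ε
  rw [Finset.prod_mul_distrib]
  set P := ∏ n, ε n
  set A := ∏ n : Fin N, ε n.castSucc
  set B := ∏ n : Fin N, ε n.succ
  have e3 : A = P * ε (Fin.last N) := by rw [e2, mul_assoc, h, mul_one]
  have e4 : B = ε 0 * P := by rw [e1, ← mul_assoc, h, one_mul]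
  rw [e3, e4]
  linear_combination (ε 0 * ε (Fin.last N)) * hP

theorem FlowData.value_linePath (hJ : IsSymmetry J) (hJ₀ : J * I₀ * J = -I₀)
    (hJ₁ : J * I₁ * J = -I₁) (h₀ : IsComplexStructure I₀) (h₁ : IsComplexStructure I₁)
    [FiniteDimensional ℝ (sumKer I₀ I₁)] (D : FlowData (linePath I₀ I₁)) :
    D.value = (SignType.sign (LinearMap.det (kerSymm hJ hJ₀ hJ₁).toLinearMap) : ℤ) := by
  have hε := fun n => exists_isPointSign h₀ h₁ (sign_det_mul_self (kerSymm hJ hJ₀ hJ₁))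
    (D.R_skew n) (D.R_range n) (D.R_injective n)
  choose ε hε using hε
  have ht : ∀ n, D.t n ∈ Set.Icc (0 : ℝ) 1 := fun n =>
    ⟨D.t_zero ▸ D.t_strictMono.monotone (Fin.zero_le n),
      D.t_last ▸ D.t_strictMono.monotone (Fin.le_last n)⟩
  have hval : D.value = ∏ n : Fin D.N, ε n.castSucc * ε n.succ := by
    refine Finset.prod_congr rfl fun n _ => ?_
    have hlt : D.t n.castSucc < D.t n.succ := D.t_strictMono Fin.castSucc_lt_succ
    have m₀ := Set.left_mem_Icc.2 hlt.le
    have m₁ := Set.right_mem_Icc.2 hlt.le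
    have := D.finiteDimensional n _ m₀
    have := D.finiteDimensional n _ m₁
    have q₀ := D.isSpectralProjection n _ m₀
    have q₁ := D.isSpectralProjection n _ m₁
    have hQ := q₀.eq_of_norm_sub_lt h₀ h₁ (D.a_pos n) (ht _) (ht _) q₁
      (D.norm_sub_lt n _ m₀ _ m₁)
    have hc := commute_of_commute_linePath hlt.ne q₀.commute (hQ ▸ q₁.commute)
    rw [pieceFlow_of_eq hQ q₀.isStarProjection]
    refine finiteFlow_piece hJ hJ₀ hJ₁ h₀ h₁ q₀.isStarProjection hc.1 hc.2 (ht _) (ht _) hlt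
      (fun hm x hx => ?_) (D.R_skew _) (D.R_skew _) (D.R_range _) (D.R_range _) (hε _) (hε _)
    -- When the piece meets `1/2`, its constant projection is also the spectral projection at `1/2`,
    -- whose range contains the kernel.
    have q := D.isSpectralProjection n _ hm
    have hQ' := q₀.eq_of_norm_sub_lt h₀ h₁ (D.a_pos n) (ht _) (by norm_num) q
      (D.norm_sub_lt n _ m₀ _ hm)
    rw [hQ']
    exact IsStarProjection.mem_ran
      (q.apply_eq_self (D.a_pos n) (linePath_half_eq_zero_iff.2 hx))
  rw [hval, prod_castSucc_mul_succ ε fun n => (hε n).mul_self,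
    (hε 0).eq_one (by rw [D.t_zero]; norm_num),
    (hε (Fin.last _)).eq_of_lt (by rw [D.t_last]; norm_num), one_mul]

end Flow

/-! ### Admissibility of the line and existence of choices. -/

section Existence

universe u

variable {H : Type u} [NormedAddCommGroup H] [InnerProductSpace ℝ H] [CompleteSpace H]

variable {J I₀ I₁ : H →L[ℝ] H}

theorem isSpectralProjection_zero (h₀ : IsComplexStructure I₀) (h₁ : IsComplexStructure I₁)
    {s a : ℝ} (hs : s ∈ Set.Icc (0 : ℝ) 1) (ha : a ≤ |1 - 2 * s|) :
    IsSpectralProjection (linePath I₀ I₁ s) a 0 where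
  isStarProjection := ⟨IsIdempotentElem.zero, IsSelfAdjoint.zero _⟩
  commute := Commute.zero_left _
  lt_on_range x hx hx0 := absurd hx.symm hx0
  le_on_ker x _ := by
    have h := IsComplexStructure.norm_linePath_sq h₀ h₁ s x
    have h2 : 0 ≤ s * (1 - s) * ‖(I₀ + I₁) x‖ ^ 2 :=
      mul_nonneg (mul_nonneg hs.1 (sub_nonneg.2 hs.2)) (sq_nonneg _)
    refine (mul_le_mul_of_nonneg_right ha (norm_nonneg x)).trans ?_
    refine le_of_sq_le_sq ?_ (norm_nonneg _)
    rw [mul_pow, sq_abs]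
    linarith

theorem commute_starProjection_sumKer [FiniteDimensional ℝ (sumKer I₀ I₁)] {I : H →L[ℝ] H}
    (hI : star I = -I) (h : ∀ x ∈ sumKer I₀ I₁, I x ∈ sumKer I₀ I₁) :
    Commute (sumKer I₀ I₁).starProjection I := by
  set P := (sumKer I₀ I₁).starProjection
  have hP : star P = P := isSelfAdjoint_starProjection _
  have e : P * (I * P) = I * P := by
    ext x
    exact Submodule.starProjection_eq_self_iff.2
      (h _ (Submodule.starProjection_apply_mem _ x))
  have e' := congrArg star e
  simp only [star_mul, hP, hI, neg_mul, mul_neg, neg_inj] at e'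
  rw [mul_assoc] at e'
  exact e'.symm.trans e

theorem isSpectralProjection_starProjection [FiniteDimensional ℝ (sumKer I₀ I₁)]
    (h₀ : IsComplexStructure I₀) (h₁ : IsComplexStructure I₁) {s b : ℝ} (hb : |1 - 2 * s| < b)
    (h : ∀ x ∈ (sumKer I₀ I₁)ᗮ, b * ‖x‖ ≤ ‖linePath I₀ I₁ s x‖) :
    IsSpectralProjection (linePath I₀ I₁ s) b (sumKer I₀ I₁).starProjection where
  isStarProjection :=
    ⟨Submodule.isIdempotentElem_starProjection _, isSelfAdjoint_starProjection _⟩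
  commute := by
    refine commute_linePath (commute_starProjection_sumKer h₀.skew fun x hx =>
      h₀.map_mem_sumKer h₁ hx) (commute_starProjection_sumKer h₁.skew fun x hx => ?_) s
    rw [mem_sumKer, add_comm]
    exact h₁.map_mem_sumKer h₀ (by rw [mem_sumKer, add_comm]; exact hx)
  lt_on_range x hx hx0 := by
    have hxK : (I₀ + I₁) x = 0 := Submodule.starProjection_eq_self_iff.1 hx
    have e := IsComplexStructure.norm_linePath_sq h₀ h₁ s x
    rw [hxK, norm_zero, zero_pow two_ne_zero, mul_zero, add_zero, ← sq_abs (1 - 2 * s), ← mul_pow,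
      sq_eq_sq₀ (norm_nonneg _) (by positivity)] at e
    rw [e]
    exact mul_lt_mul_of_pos_right hb (norm_pos_iff.2 hx0)
  le_on_ker x hx := h x ((Submodule.starProjection_apply_eq_zero_iff _).1 hx)

theorem le_norm_linePath (h₀ : IsComplexStructure I₀) (h₁ : IsComplexStructure I₁)
    {c s : ℝ} (hs : s ∈ Set.Icc (1 / 4 : ℝ) (3 / 4)) {x : H}
    (hc : 0 < c) (h : c * ‖x‖ ≤ ‖(I₀ + I₁) x‖) : c / 4 * ‖x‖ ≤ ‖linePath I₀ I₁ s x‖ := by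
  refine le_of_sq_le_sq ?_ (norm_nonneg _)
  rw [IsComplexStructure.norm_linePath_sq h₀ h₁]
  have h2 := pow_le_pow_left₀ (by positivity) h 2
  -- The weaker bound `1/16`, instead of the true minimum `3/16`, has the square root `1/4` that
  -- appears in `c / 4`.
  have h3 : 1 / 16 ≤ s * (1 - s) := by nlinarith [hs.1, hs.2]
  have h4 := mul_le_mul h3 h2 (by positivity) (by linarith)
  nlinarith [mul_nonneg (sq_nonneg (1 - 2 * s)) (sq_nonneg ‖x‖)]

/-- Three pieces suffice. Away from `1/2` the path is bounded below by `|1 - 2s| ≥ 2δ`, and the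
projection at level `2δ` is zero. Near `1/2` the level `c / 4` separates the kernel of the sum,
where the path scales norms by `|1 - 2s| ≤ 2δ < c / 4`, from its complement. -/
theorem nonempty_flowData (h₀ : IsComplexStructure I₀) (h₁ : IsComplexStructure I₁)
    [FiniteDimensional ℝ (sumKer I₀ I₁)] {c : ℝ} (hc : 0 < c)
    (h : ∀ x ∈ (sumKer I₀ I₁)ᗮ, c * ‖x‖ ≤ ‖(I₀ + I₁) x‖) :
    Nonempty (FlowData (linePath I₀ I₁)) := by
  -- `δ ≤ 1/8` keeps the middle piece inside `[1/4, 3/4]`, where `le_norm_linePath` applies.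
  obtain ⟨δ, hδ, hδ8, hδc⟩ : ∃ δ > 0, δ ≤ 1 / 8 ∧ 2 * δ < c / 4 :=
    ⟨min (1 / 8) (c / 16), by positivity, min_le_left _ _, by
      have := min_le_right (1 / 8) (c / 16); linarith⟩
  let t : Fin 4 → ℝ := ![0, 1 / 2 - δ, 1 / 2 + δ, 1]
  let a : Fin 3 → ℝ := ![2 * δ, c / 4, 2 * δ]
  let Q : Fin 3 → H →L[ℝ] H := ![0, (sumKer I₀ I₁).starProjection, 0]
  have hQ : ∀ n : Fin 3, ∀ s ∈ Set.Icc (t n.castSucc) (t n.succ),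
      IsSpectralProjection (linePath I₀ I₁ s) (a n) (Q n) := by
    intro n s hs
    fin_cases n
    · have hs : 0 ≤ s ∧ s ≤ 1 / 2 - δ := hs
      exact isSpectralProjection_zero h₀ h₁ ⟨hs.1, by linarith⟩
        (le_abs.2 (Or.inl (show 2 * δ ≤ 1 - 2 * s by linarith)))
    · have hs : 1 / 2 - δ ≤ s ∧ s ≤ 1 / 2 + δ := hs
      exact isSpectralProjection_starProjection h₀ h₁
        ((abs_le.2 ⟨by linarith, by linarith⟩ : |1 - 2 * s| ≤ 2 * δ).trans_lt hδc) fun x hx =>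
          le_norm_linePath h₀ h₁ ⟨by linarith, by linarith⟩ hc (h x hx)
    · have hs : 1 / 2 + δ ≤ s ∧ s ≤ 1 := hs
      exact isSpectralProjection_zero h₀ h₁ ⟨by linarith, hs.2⟩
        (le_abs.2 (Or.inr (show 2 * δ ≤ -(1 - 2 * s) by linarith)))
  have hne : ∀ n, t n ∈ Set.Icc (0 : ℝ) 1 ∧ t n ≠ 1 / 2 := by
    intro n
    fin_cases n
    · exact ⟨⟨le_rfl, zero_le_one⟩, show (0 : ℝ) ≠ 1 / 2 by norm_num⟩
    · exact ⟨⟨show 0 ≤ 1 / 2 - δ by linarith, show 1 / 2 - δ ≤ 1 by linarith⟩,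
        show 1 / 2 - δ ≠ 1 / 2 by linarith⟩
    · exact ⟨⟨show 0 ≤ 1 / 2 + δ by linarith, show 1 / 2 + δ ≤ 1 by linarith⟩,
        show 1 / 2 + δ ≠ 1 / 2 by linarith⟩
    · exact ⟨⟨zero_le_one, le_rfl⟩, show (1 : ℝ) ≠ 1 / 2 by norm_num⟩
  exact ⟨{
    N := 3
    t := t
    t_strictMono := by
      refine Fin.strictMono_iff_lt_succ.2 fun n => ?_
      fin_cases n
      · change 0 < 1 / 2 - δ; linarith
      · change 1 / 2 - δ < 1 / 2 + δ; linarith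
      · change 1 / 2 + δ < 1; linarith
    t_zero := rfl
    t_last := rfl
    a := a
    a_pos := by
      intro n
      fin_cases n
      · change 0 < 2 * δ; linarith
      · change 0 < c / 4; linarith
      · change 0 < 2 * δ; linarith
    Q := fun n _ => Q n
    isSpectralProjection := hQ
    finiteDimensional := by
      intro n s _
      fin_cases n
      · change FiniteDimensional ℝ (ran (0 : H →L[ℝ] H))
        rw [ran, show ((0 : H →L[ℝ] H).toLinearMap) = 0 from rfl, LinearMap.range_zero]
        infer_instance
      · change FiniteDimensional ℝ (ran (sumKer I₀ I₁).starProjection)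
        rw [ran, show LinearMap.range (sumKer I₀ I₁).starProjection.toLinearMap = sumKer I₀ I₁ from
          Submodule.range_starProjection _]
        infer_instance
      · change FiniteDimensional ℝ (ran (0 : H →L[ℝ] H))
        rw [ran, show ((0 : H →L[ℝ] H).toLinearMap) = 0 from rfl, LinearMap.range_zero]
        infer_instance
    continuousOn := fun n => continuousOn_const
    norm_sub_lt := fun n s _ s' _ => by rw [sub_self, norm_zero]; exact one_pos
    -- No partition point is `1/2`, so all the kernels to be filled are trivial.
    R := 0
    R_skew := fun n => by simp
    R_range := fun n x => by simp
    R_injective := fun n x hx _ => linePath_injective h₀ h₁ (hne n).1 (hne n).2 hx }⟩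

theorem linePath_mem_skewFredholm (h₀ : IsComplexStructure I₀) (h₁ : IsComplexStructure I₁)
    [FiniteDimensional ℝ (sumKer I₀ I₁)] {c : ℝ} (hc : 0 < c)
    (h : ∀ x ∈ (sumKer I₀ I₁)ᗮ, c * ‖x‖ ≤ ‖(I₀ + I₁) x‖) {s : ℝ} (hs : s ∈ Set.Icc (0 : ℝ) 1) :
    linePath I₀ I₁ s ∈ skewFredholm H := by
  have hsk := IsComplexStructure.star_linePath h₀ h₁ s
  refine ⟨hsk, ?_⟩
  by_cases hs' : s = 1 / 2
  · subst hs'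
    refine isFredholm_of_skew_of_le_norm hsk (c := (c / 4) ^ 2) (by positivity) (sumKer I₀ I₁)
      (fun x hx => linePath_half_eq_zero_iff.2 hx) fun x hx => ?_
    rw [← mul_pow]
    exact pow_le_pow_left₀ (by positivity)
      (le_norm_linePath h₀ h₁ (by norm_num) hc (h x hx)) 2
  · have hpos : 0 < (1 - 2 * s) ^ 2 := by
      have : 1 - 2 * s ≠ 0 := fun h => hs' (by linarith)
      positivity
    refine isFredholm_of_skew_of_le_norm hsk hpos ⊥ (fun x hx => ?_) fun x _ => ?_
    · rw [(Submodule.mem_bot ℝ).1 hx, map_zero]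
    · rw [IsComplexStructure.norm_linePath_sq h₀ h₁]
      exact le_add_of_nonneg_right
        (mul_nonneg (mul_nonneg hs.1 (sub_nonneg.2 hs.2)) (sq_nonneg _))

theorem IsComplexStructure.isUnit {I : H →L[ℝ] H} (hI : IsComplexStructure I) : IsUnit I :=
  isUnit_of_skew_of_le_norm hI.skew one_pos fun x => by rw [hI.norm_map, one_mul]

theorem isAdmissiblePath_linePath (h₀ : IsComplexStructure I₀) (h₁ : IsComplexStructure I₁)
    [FiniteDimensional ℝ (sumKer I₀ I₁)] {c : ℝ} (hc : 0 < c)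
    (h : ∀ x ∈ (sumKer I₀ I₁)ᗮ, c * ‖x‖ ≤ ‖(I₀ + I₁) x‖) :
    IsAdmissiblePath (linePath I₀ I₁) where
  continuousOn := by
    unfold linePath
    fun_prop
  mem _ ht := linePath_mem_skewFredholm h₀ h₁ hc h ht
  isUnit_zero := by rw [linePath_zero]; exact h₀.isUnit
  isUnit_one := by rw [linePath_one]; exact h₁.isUnit

/-- Evaluating both values on one existing `FlowData` identifies them; without such a datum every
`σ` would qualify vacuously. -/
theorem HasZ2SpectralFlow.z2SpectralFlow_eq {T : ℝ → H →L[ℝ] H} {σ : ℤ}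
    (h : HasZ2SpectralFlow T σ) : z2SpectralFlow T = σ := by
  have hex : ∃ σ, HasZ2SpectralFlow T σ := ⟨σ, h⟩
  rw [z2SpectralFlow, dif_pos hex]
  obtain ⟨D⟩ := h.2.1
  rw [← h.2.2 D, hex.choose_spec.2.2 D]

theorem mul_linePath_mul (hJ₀ : J * I₀ * J = -I₀) (hJ₁ : J * I₁ * J = -I₁) (s : ℝ) :
    J * linePath I₀ I₁ s * J = -linePath I₀ I₁ s := by
  simp only [linePath, mul_add, add_mul, mul_smul_comm, smul_mul_assoc, hJ₀, hJ₁, smul_neg,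
    neg_add]

end Existence

end ChiralFlow

end

theorem mainTheorem3 {H : Type*} [NormedAddCommGroup H] [InnerProductSpace ℝ H] [CompleteSpace H]
    (J : H →L[ℝ] H) (hJ : ChiralFlow.IsSymmetry J)
    (I₀ I₁ : H →L[ℝ] H) (hI : ChiralFlow.IsFredholmPair J I₀ I₁) :
    (∀ t ∈ Set.Icc (0 : ℝ) 1, ChiralFlow.linePath I₀ I₁ t ∈ ChiralFlow.chiralSkewFredholm J) ∧
    FiniteDimensional ℝ (LinearMap.ker (I₀ + I₁ : H →L[ℝ] H).toLinearMap) ∧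
    Even (Module.finrank ℝ (LinearMap.ker (I₀ + I₁ : H →L[ℝ] H).toLinearMap)) ∧
    ChiralFlow.z2SpectralFlow (ChiralFlow.linePath I₀ I₁) =
      ChiralFlow.z2Sign (ChiralFlow.z2Index I₀ I₁) := by
  have h₀ := hI.left.toIsComplexStructure
  have h₁ := hI.right.toIsComplexStructure
  have hfd := ChiralFlow.finiteDimensional_ker_add h₀ hI.calkinNorm_lt
  obtain ⟨c, hc, hcK⟩ := ChiralFlow.exists_le_norm_add h₀ hI.calkinNorm_lt
  have hdet := ChiralFlow.kerSymm_det hJ h₀ h₁ hI.left.chiral hI.right.chiral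
  refine ⟨fun t ht => ⟨ChiralFlow.linePath_mem_skewFredholm h₀ h₁ hc hcK ht,
    ChiralFlow.mul_linePath_mul hI.left.chiral hI.right.chiral t⟩, hfd, hdet.1, ?_⟩
  rw [← hdet.2]
  exact ChiralFlow.HasZ2SpectralFlow.z2SpectralFlow_eq
    ⟨ChiralFlow.isAdmissiblePath_linePath h₀ h₁ hc hcK,
      ChiralFlow.nonempty_flowData h₀ h₁ hc hcK, fun D =>
      D.value_linePath hJ hI.left.chiral hI.right.chiral h₀ h₁⟩
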